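/- Let $\mathbb{F}_q$ be a finite field with $q$ elements, let $r \ge 2$, let $n \ge 2$ be a composite integer, and let $\ell$ be the smallest prime divisor of $n$. Fix a monomial order on $\mathbb{F}_q[x_1,\dots,x_r]$ (for example, the degree-lexicographic one); a polynomial is monic if its leading coefficient with respect to this order is $1$. Let $D_{r,n}(\mathbb{F}_q)$ be the set of all monic $f \in \mathbb{F}_q[x_1,\dots,x_r]$ of total degree $n$ with $f(0,\dots,0)=0$ that are decomposable, that is, $f = g(h)$ for some monic univariate $g \in \mathbb{F}_q[y]$ with $\deg g \ge 2$ and some monic $h \in \mathbb{F}_q[x_1,\dots,x_r]$ of total degree at least $1$. Let $$m = \begin{cases} n & \text{if } r = 2,\ n/\ell \text{ is prime, and } n/\ell \le 2\ell - 5,\\ \ell & \text{otherwise,}\end{cases}$$ $$\alpha_{r,n} = q^{\binom{r+n/m}{r} + m - 3}\,\frac{1 - q^{-\binom{r-1+n/m}{r-1}}}{1 - q^{-1}}, \qquad \beta_{r,n} = \frac{2\,q^{-\frac12\binom{r-1+n/\ell}{r-1} + 1}}{1 - q^{-1}}.$$ Then $D_{r,n}(\mathbb{F}_q)$ is finite and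 $$\left|\#D_{r,n}(\mathbb{F}_q) - \alpha_{r,n}\right| \le \alpha_{r,n}\cdot\beta_{r,n}.$$ -/

import Mathlib

/-- `P_{r,n}(F)`: the `r`-variate polynomials over `F` of total degree exactly `n` that are monic,
i.e. have leading coefficient `1`, with respect to the monomial order `mo`. -/
def monicPolys {r : ℕ} (mo : MonomialOrder (Fin r)) (n : ℕ) (F : Type*) [Field F] :
    Set (MvPolynomial (Fin r) F) :=
  {f | f.totalDegree = n ∧ mo.Monic f}

/-- `(g, h)` is a (uni-multivariate) decomposition of `f`: `g` is univariate monic of degree at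
least `2`, `h` is `r`-variate monic of degree at least `1`, and `f = g ∘ h = g(h)`. -/
def IsDecomposition {r : ℕ} {F : Type*} [Field F] (mo : MonomialOrder (Fin r))
    (g : Polynomial F) (h f : MvPolynomial (Fin r) F) : Prop :=
  g.Monic ∧ 2 ≤ g.natDegree ∧ mo.Monic h ∧ 1 ≤ h.totalDegree ∧ f = Polynomial.aeval h g

/-- `D_{r,n}(F)`: the decomposable polynomials in `P_{r,n}(F)` that vanish at the origin. -/
def decomposablePolys {r : ℕ} (mo : MonomialOrder (Fin r)) (n : ℕ) (F : Type*) [Field F] :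
    Set (MvPolynomial (Fin r) F) :=
  {f | f ∈ monicPolys mo n F ∧ (∃ g h, IsDecomposition mo g h f) ∧ MvPolynomial.eval 0 f = 0}

/-- The number `m`, where `ℓ = n.minFac` is the smallest prime divisor of `n`. -/
def decompM (r n : ℕ) : ℕ :=
  if r = 2 ∧ (n / n.minFac).Prime ∧ ((n / n.minFac : ℕ) : ℤ) ≤ 2 * (n.minFac : ℤ) - 5 then n
  else n.minFac

/-- `α_{r,n} = q^(binom(r+n/m, r) + m - 3) (1 - q^(-binom(r-1+n/m, r-1))) / (1 - q⁻¹)`. -/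
noncomputable def decompAlpha (q r n : ℕ) : ℝ :=
  (q : ℝ) ^ (((r + n / decompM r n).choose r : ℤ) + (decompM r n : ℤ) - 3) *
    ((1 - (q : ℝ) ^ (-((r - 1 + n / decompM r n).choose (r - 1) : ℤ))) / (1 - (q : ℝ)⁻¹))

/-- `β_{r,n} = 2 q^(-binom(r-1+n/ℓ, r-1)/2 + 1) / (1 - q⁻¹)` (a real power), where `ℓ = n.minFac`
is the smallest prime divisor of `n`. -/
noncomputable def decompBeta (q r n : ℕ) : ℝ :=
  2 * (q : ℝ) ^ (-(1 / 2 : ℝ) * ((r - 1 + n / n.minFac).choose (r - 1) : ℝ) + 1) /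
    (1 - (q : ℝ)⁻¹)

/-! Subtracting the constant of `h` and absorbing it into `g`, every decomposable polynomial is some
`g(h)` with `g` and `h` vanishing at the origin, and `deg g = d` for a divisor `d ≥ 2` of `n`.
Counting pairs gives an upper bound `∑ pairCount q r d (n/d)`. The exponent `binom(r+n/d, r) + d` is
dominated by `d = ℓ` or, when `r = 2`, possibly by `d = n`. All other divisors together contribute
at most `αβ`.

For the lower bound, composition must be injective on almost all pairs with `d = m`. If `m = n`,
then `h` is linear and equals its top form, so uniqueness is immediate. If `m = ℓ` is prime,
uniqueness holds once the top form `a` of `h` is not a constant times a proper power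
(`decomposition_unique_of_prime`). To see this, pass to `h(xT)`, a polynomial in `T` with leading
coefficient `a`, and let `Δ` be the difference of two inner components, rescaled to a common top
form. If `ℓ` is invertible, comparing degrees in `T` gives `Δ = 0`. If `ℓ` is the characteristic,
Frobenius turns the equation into one for `Δ^ℓ`, and comparing leading terms shows that a power of
the leading coefficient of `Δ` is a constant times a smaller power of `a`. Unique factorization then
makes `a` a proper power. Such forms are a proportion at most `β` of all forms, because a base has
at most half the degree. -/

/-! ### Leading terms of compositions in one variable over a domain -/

open Polynomial in
lemma natDegree_aeval_polynomial {K A : Type*} [Field K] [CommRing A] [IsDomain A] [Algebra K A]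
    (g : K[X]) (H : A[X]) : (aeval H g).natDegree = g.natDegree * H.natDegree := by
  have : aeval H g = (g.map (algebraMap K A)).comp H := by
    rw [Polynomial.comp, eval₂_map, aeval_def]; rfl
  rw [this, natDegree_comp, natDegree_map]

open Polynomial in
lemma leadingCoeff_aeval_polynomial {K A : Type*} [Field K] [CommRing A] [IsDomain A] [Algebra K A]
    (g : K[X]) (H : A[X]) (hH : H.natDegree ≠ 0) : (aeval H g).leadingCoeff =
      algebraMap K A g.leadingCoeff * H.leadingCoeff ^ g.natDegree := by
  have : aeval H g = (g.map (algebraMap K A)).comp H := by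
    rw [Polynomial.comp, eval₂_map, aeval_def]; rfl
  rw [this, leadingCoeff_comp hH, natDegree_map, leadingCoeff_map]

open Polynomial in
/-- The leading term of `g(H') - g(H)` when `H` and `H'` have the same leading term. -/
lemma natDegree_leadingCoeff_aeval_sub {K A : Type*} [Field K] [CommRing A] [IsDomain A]
    [Algebra K A] (g : K[X]) (H H' : A[X]) {e j : ℕ} {a : A} (he : 0 < e) (ha : a ≠ 0)
    (hH : H.natDegree = e) (hH' : H'.natDegree = e) (hHa : H.leadingCoeff = a)
    (hHa' : H'.leadingCoeff = a) (hg : g.natDegree = j + 1) (hj : ((j + 1 : ℕ) : K) ≠ 0)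
    (hne : H' - H ≠ 0) :
    (aeval H' g - aeval H g).natDegree = (H' - H).natDegree + j * e ∧
    (aeval H' g - aeval H g).leadingCoeff =
      (H' - H).leadingCoeff * (algebraMap K A (g.leadingCoeff * (j + 1 : ℕ)) * a ^ j) := by
  -- The cofactor of `H' - H` given by `x^i - y^i = (x - y) ∑ x^k y^(i-1-k)`. Only `i = j + 1`
  -- reaches degree `j * e`, where `j + 1` summands each contribute `a ^ j`; hence the assumption
  -- `hj`.
  set S : A[X] := ∑ i ∈ Finset.range (j + 2),
    g.coeff i • ∑ k ∈ Finset.range i, H' ^ k * H ^ (i - 1 - k) with hS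
  have hfac : aeval H' g - aeval H g = (H' - H) * S := by
    rw [aeval_eq_sum_range' (n := j + 2) (by omega), aeval_eq_sum_range' (n := j + 2) (by omega),
      ← Finset.sum_sub_distrib, hS, Finset.mul_sum]
    refine Finset.sum_congr rfl fun i _ => ?_
    rw [← smul_sub, mul_smul_comm, ← (Commute.all H' H).mul_geom_sum₂]
  have hterm : ∀ i k, k < i → (H' ^ k * H ^ (i - 1 - k)).natDegree = (i - 1) * e := by
    intro i k hk
    have hH0 : H ≠ 0 := by rintro rfl; simp at hH; omega
    have hH0' : H' ≠ 0 := by rintro rfl; simp at hH'; omega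
    rw [natDegree_mul (pow_ne_zero _ hH0') (pow_ne_zero _ hH0), natDegree_pow, natDegree_pow,
      hH, hH', ← add_mul]
    congr 1; omega
  have hcoef : S.coeff (j * e) = algebraMap K A (g.leadingCoeff * (j + 1 : ℕ)) * a ^ j := by
    rw [hS, finsetSum_coeff, Finset.sum_range_succ, Finset.sum_eq_zero, zero_add, coeff_smul,
      finsetSum_coeff, Finset.sum_congr rfl (g := fun _ => a ^ j)]
    · simp [← hg, Algebra.smul_def, mul_assoc]
    · intro k hk
      have hk' := Finset.mem_range.1 hk
      have h1 := hterm (j + 1) k hk'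
      rw [Nat.add_sub_cancel] at h1 ⊢
      rw [← h1, coeff_natDegree, leadingCoeff_mul, leadingCoeff_pow, leadingCoeff_pow, hHa, hHa',
        ← pow_add]
      congr 1; omega
    · intro i hi
      rw [coeff_smul, finsetSum_coeff, Finset.sum_eq_zero, smul_zero]
      intro k hk
      have hk' := Finset.mem_range.1 hk
      have hi' := Finset.mem_range.1 hi
      refine coeff_eq_zero_of_natDegree_lt ?_
      rw [hterm i k hk']
      exact Nat.mul_lt_mul_of_pos_right (by omega) he
  have hne0 : algebraMap K A (g.leadingCoeff * (j + 1 : ℕ)) * a ^ j ≠ 0 := by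
    refine mul_ne_zero ?_ (pow_ne_zero _ ha)
    rw [Ne, map_eq_zero]
    refine mul_ne_zero ?_ hj
    rw [Ne, leadingCoeff_eq_zero]; rintro rfl; simp at hg
  have hdeg : S.natDegree ≤ j * e := by
    refine natDegree_sum_le_of_forall_le _ _ fun i hi => ?_
    refine (natDegree_smul_le _ _).trans ?_
    refine natDegree_sum_le_of_forall_le _ _ fun k hk => ?_
    have hk' := Finset.mem_range.1 hk
    have hi' := Finset.mem_range.1 hi
    rw [hterm i k hk']
    exact Nat.mul_le_mul_right _ (by omega)
  have hdeg' : S.natDegree = j * e :=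
    le_antisymm hdeg (le_natDegree_of_ne_zero (by rw [hcoef]; exact hne0))
  have hlc : S.leadingCoeff = algebraMap K A (g.leadingCoeff * (j + 1 : ℕ)) * a ^ j := by
    rw [leadingCoeff, hdeg', hcoef]
  have hS0 : S ≠ 0 := by rw [← leadingCoeff_ne_zero, hlc]; exact hne0
  rw [hfac, natDegree_mul hne hS0, hdeg', leadingCoeff_mul, hlc]
  exact ⟨rfl, rfl⟩

open Polynomial in
/-- If `g(H) = g'(H')` with `g`, `g'` monic of the same prime degree, and `H`, `H'` have the same
leading term and vanish at `0`, then `H = H'` or the common leading coefficient is multiplicatively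
dependent on an element of `A`. -/
lemma eq_or_exists_pow_eq_of_aeval_eq {K A : Type*} [Field K] [CommRing A] [IsDomain A]
    [Algebra K A] {d : ℕ} (hd : d.Prime) {g g' : K[X]} (hg : g.Monic) (hg' : g'.Monic)
    (hgd : g.natDegree = d) (hgd' : g'.natDegree = d) {H H' : A[X]} {e : ℕ} {a : A}
    (he : 0 < e) (ha : a ≠ 0)
    (hH : H.natDegree = e) (hH' : H'.natDegree = e) (hHa : H.leadingCoeff = a)
    (hHa' : H'.leadingCoeff = a) (h0 : H.coeff 0 = 0) (h0' : H'.coeff 0 = 0)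
    (heq : aeval H g = aeval H' g') :
    H = H' ∨ ∃ (t i j : ℕ) (w : A) (c : K), 0 < t ∧ t < e ∧ 0 < i ∧ i * t = j * e ∧ c ≠ 0 ∧
      w ^ i = algebraMap K A c * a ^ j := by
  by_cases hne : H = H'
  · exact Or.inl hne
  have hΔ : H' - H ≠ 0 := sub_ne_zero.2 (Ne.symm hne)
  set t := (H' - H).natDegree with ht
  have ht0 : 0 < t := by
    rw [Nat.pos_iff_ne_zero]
    intro h
    have h1 := eq_C_of_natDegree_eq_zero (ht.symm.trans h)
    rw [coeff_sub, h0, h0', sub_zero, C_0] at h1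
    exact hΔ h1
  have hte : t < e := by
    have hdl : (H' - H).degree < H'.degree := by
      refine degree_sub_lt_left ?_ ?_ (hHa'.trans hHa.symm)
      · rw [degree_eq_natDegree, degree_eq_natDegree, hH, hH'] <;> rintro rfl <;> simp_all
      · rintro rfl; simp at hH'; omega
    have := natDegree_lt_natDegree hΔ hdl
    omega
  have hcdeg : (g - g').natDegree < d := by
    have : (g - g').degree < g.degree := by
      refine degree_sub_lt_left ?_ hg.ne_zero (by rw [hg.leadingCoeff, hg'.leadingCoeff])
      rw [degree_eq_natDegree hg.ne_zero, degree_eq_natDegree hg'.ne_zero, hgd, hgd']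
    by_cases h : g - g' = 0
    · rw [h, natDegree_zero]; exact hd.pos
    · exact hgd ▸ natDegree_lt_natDegree h this
  -- The wild case, where the prime `d` is the characteristic. Splitting `g = X ^ d + G` makes the
  -- main part additive.
  by_cases hdK : (d : K) = 0
  · have hchar : CharP A[X] d := by
      rw [CharP.charP_iff_prime_eq_zero hd]
      have h1 : algebraMap K A[X] (d : K) = 0 := by rw [hdK, map_zero]
      rwa [map_natCast] at h1
    have : Fact d.Prime := ⟨hd⟩
    have hGdeg : (g - X ^ d).natDegree < d := by
      have : (g - X ^ d).degree < g.degree := by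
        refine degree_sub_lt_left ?_ hg.ne_zero (by rw [hg.leadingCoeff, leadingCoeff_X_pow])
        rw [degree_eq_natDegree hg.ne_zero, hgd, degree_X_pow]
      by_cases h : g - X ^ d = 0
      · rw [h, natDegree_zero]; exact hd.pos
      · exact (natDegree_lt_natDegree h this).trans_eq hgd
    set G := g - X ^ d with hG
    have hkey : (H' - H) ^ d = aeval H' (g - g') - (aeval H' G - aeval H G) := by
      rw [sub_pow_char, hG, map_sub, map_sub, map_sub, ← heq]
      simp only [map_pow, aeval_X]
      ring
    have hdeg : d * t = (aeval H' (g - g') - (aeval H' G - aeval H G)).natDegree := by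
      rw [← hkey, natDegree_pow]
    have hlead : (H' - H).leadingCoeff ^ d =
        (aeval H' (g - g') - (aeval H' G - aeval H G)).leadingCoeff := by
      rw [← hkey, leadingCoeff_pow]
    have hdt : 0 < d * t := Nat.mul_pos hd.pos ht0
    have hcd : (aeval H' (g - g')).natDegree = (g - g').natDegree * e := by
      rw [natDegree_aeval_polynomial, hH']
    have hcl : (aeval H' (g - g')).leadingCoeff =
        algebraMap K A (g - g').leadingCoeff * a ^ (g - g').natDegree := by
      rw [leadingCoeff_aeval_polynomial _ _ (by omega), hHa']
    -- If `(g - g')(H')` dominates, its leading term is that of `(H' - H) ^ d`, which gives the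
    -- relation with `i = d` and `j = deg (g - g')`.
    have hfirst : ∀ E : A[X], E.natDegree < (aeval H' (g - g')).natDegree →
        (H' - H) ^ d = aeval H' (g - g') - E →
        ∃ (t i j : ℕ) (w : A) (c : K), 0 < t ∧ t < e ∧ 0 < i ∧ i * t = j * e ∧ c ≠ 0 ∧
          w ^ i = algebraMap K A c * a ^ j := by
      intro E hE hEq
      refine ⟨t, d, (g - g').natDegree, (H' - H).leadingCoeff, (g - g').leadingCoeff, ht0, hte,
        hd.pos, ?_, ?_, ?_⟩
      · rw [← hcd, ← natDegree_sub_eq_left_of_natDegree_lt hE, ← hEq, natDegree_pow]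
      · rw [Ne, leadingCoeff_eq_zero]
        intro h
        rw [h] at hE
        simp at hE
      · rw [← hcl, ← leadingCoeff_pow, hEq, leadingCoeff_sub_of_degree_lt (degree_lt_degree hE)]
    right
    rcases Nat.eq_zero_or_pos G.natDegree with hj | hj
    · have hz : aeval H' G - aeval H G = 0 := by
        rw [eq_C_of_natDegree_eq_zero hj, aeval_C, aeval_C, sub_self]
      refine hfirst _ ?_ hkey
      rw [hz, sub_zero] at hdeg
      rw [hz, natDegree_zero]
      omega
    · obtain ⟨j, hj'⟩ : ∃ j, G.natDegree = j + 1 := ⟨G.natDegree - 1, by omega⟩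
      -- `deg G` lies strictly between `0` and `d`, so it is prime to the characteristic.
      have hjK : ((j + 1 : ℕ) : K) ≠ 0 := by
        have : CharP K d := (CharP.charP_iff_prime_eq_zero hd).2 hdK
        rw [Ne, CharP.cast_eq_zero_iff K d]
        intro h
        have := Nat.le_of_dvd (by omega) h
        omega
      obtain ⟨hEd, hEl⟩ :=
        natDegree_leadingCoeff_aeval_sub G H H' he ha hH hH' hHa hHa' hj' hjK hΔ
      rw [← ht] at hEd
      rcases lt_trichotomy (aeval H' (g - g')).natDegree (t + j * e) with h | h | h
      · have hlt : (aeval H' (g - g')).natDegree < (aeval H' G - aeval H G).natDegree := by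
          rw [hEd]; exact h
        rw [natDegree_sub_eq_right_of_natDegree_lt hlt, hEd] at hdeg
        rw [leadingCoeff_sub_of_degree_lt' (degree_lt_degree hlt), hEl] at hlead
        have hd1 : d = (d - 1) + 1 := by have := hd.one_lt; omega
        -- Here `G(H') - G(H)` dominates. Its leading coefficient contains one factor `lc(H' - H)`;
        -- cancelling it leaves the exponent `d - 1`.
        refine ⟨t, d - 1, j, (H' - H).leadingCoeff, -(G.leadingCoeff * (j + 1 : ℕ)), ht0, hte,
          by have := hd.one_lt; omega, ?_, ?_, ?_⟩
        · rw [hd1, add_mul, one_mul] at hdeg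
          omega
        · refine neg_ne_zero.2 (mul_ne_zero ?_ hjK)
          rw [Ne, leadingCoeff_eq_zero]
          intro h
          rw [h] at hj; simp at hj
        · refine mul_left_cancel₀ (leadingCoeff_ne_zero.2 hΔ) ?_
          rw [← pow_succ', ← hd1, hlead, map_neg]
          ring
      -- Equal degrees would force `e ∣ t`, against `0 < t < e`.
      · exfalso
        rw [hcd] at h
        have h1 : e ∣ t := (Nat.dvd_add_left (Dvd.intro_left j rfl)).1 (h ▸ Dvd.intro_left _ rfl)
        have := Nat.le_of_dvd ht0 h1
        omega
      · exact hfirst _ (by rw [hEd]; exact h) hkey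
  -- The tame case: `g(H') - g(H)` has degree `t + (d-1)e`, but it equals `(g - g')(H')`, of degree
  -- at most `(d-1)e`.
  · exfalso
    obtain ⟨j, hj⟩ : ∃ j, d = j + 1 := ⟨d - 1, by have := hd.one_lt; omega⟩
    obtain ⟨hE, -⟩ := natDegree_leadingCoeff_aeval_sub g H H' he ha hH hH' hHa hHa'
      (hgd.trans hj) (hj ▸ hdK) hΔ
    rw [heq, ← map_sub, natDegree_aeval_polynomial, hH'] at hE
    have := Nat.mul_le_mul_right e (show (g - g').natDegree ≤ j by omega)
    omega

/-! ### The grading by degree, proper powers, and uniqueness of decompositions -/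

section Grading

variable {σ F : Type*} [Field F]

open Polynomial in
/-- The algebra map `f(x) ↦ f(x T)`, whose coefficients are the homogeneous components. -/
noncomputable def gradingHom (σ F : Type*) [Field F] :
    MvPolynomial σ F →ₐ[F] (MvPolynomial σ F)[X] :=
  MvPolynomial.aeval fun i => C (MvPolynomial.X i) * X

open Polynomial in
lemma gradingHom_monomial (s : σ →₀ ℕ) (c : F) :
    gradingHom σ F (MvPolynomial.monomial s c) = C (MvPolynomial.monomial s c) * X ^ s.degree := by
  rw [gradingHom, MvPolynomial.aeval_monomial, MvPolynomial.monomial_eq, Finsupp.prod,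
    Finsupp.prod, C_mul, map_prod]
  simp only [mul_pow, Finset.prod_mul_distrib, Finset.prod_pow_eq_pow_sum, ← C_pow, mul_assoc]
  rfl

lemma coeff_gradingHom (f : MvPolynomial σ F) (k : ℕ) :
    (gradingHom σ F f).coeff k = MvPolynomial.homogeneousComponent k f := by
  classical
  induction f using MvPolynomial.induction_on' with
  | monomial s c =>
    rw [gradingHom_monomial, Polynomial.coeff_C_mul_X_pow]
    have := MvPolynomial.homogeneousComponent_of_mem (n := s.degree) (m := k)
      (MvPolynomial.isHomogeneous_monomial c rfl)
    rw [this]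
  | add p q hp hq => rw [map_add, Polynomial.coeff_add, hp, hq, map_add]

lemma gradingHom_injective : Function.Injective (gradingHom σ F) := by
  intro f g h
  -- Setting `T = 1` is a left inverse.
  have : ∀ f : MvPolynomial σ F, Polynomial.aeval (1 : MvPolynomial σ F) (gradingHom σ F f) = f := by
    intro f
    induction f using MvPolynomial.induction_on' with
    | monomial s c => simp [gradingHom_monomial]
    | add p q hp hq => rw [map_add, map_add, hp, hq]
  rw [← this f, h, this g]

lemma homogeneousComponent_totalDegree_ne_zero {f : MvPolynomial σ F} (hf : f ≠ 0) :
    MvPolynomial.homogeneousComponent f.totalDegree f ≠ 0 := by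
  classical
  obtain ⟨s, hs, h⟩ := Finset.exists_mem_eq_sup f.support
    (MvPolynomial.support_nonempty.2 hf) (fun s => s.sum fun _ e => e)
  intro h0
  have h1 := congrArg (MvPolynomial.coeff s) h0
  rw [MvPolynomial.coeff_homogeneousComponent, if_pos, MvPolynomial.coeff_zero] at h1
  · exact MvPolynomial.mem_support_iff.1 hs h1
  · rw [MvPolynomial.totalDegree, h]; rfl

lemma natDegree_gradingHom (f : MvPolynomial σ F) :
    (gradingHom σ F f).natDegree = f.totalDegree := by
  by_cases hf : f = 0
  · simp [hf]
  refine le_antisymm ?_ ?_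
  · refine Polynomial.natDegree_le_iff_coeff_eq_zero.2 fun k hk => ?_
    rw [coeff_gradingHom, MvPolynomial.homogeneousComponent_eq_zero _ _ hk]
  · refine Polynomial.le_natDegree_of_ne_zero ?_
    rw [coeff_gradingHom]
    exact homogeneousComponent_totalDegree_ne_zero hf

lemma leadingCoeff_gradingHom (f : MvPolynomial σ F) :
    (gradingHom σ F f).leadingCoeff = MvPolynomial.homogeneousComponent f.totalDegree f := by
  rw [Polynomial.leadingCoeff, coeff_gradingHom, natDegree_gradingHom]

lemma gradingHom_aeval (g : Polynomial F) (h : MvPolynomial σ F) :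
    gradingHom σ F (Polynomial.aeval h g) = Polynomial.aeval (gradingHom σ F h) g :=
  (Polynomial.aeval_algHom_apply _ _ _).symm

lemma totalDegree_aeval_polynomial (g : Polynomial F) (h : MvPolynomial σ F) :
    (Polynomial.aeval h g).totalDegree = g.natDegree * h.totalDegree := by
  rw [← natDegree_gradingHom, gradingHom_aeval, natDegree_aeval_polynomial, natDegree_gradingHom]

/-- The homogeneous polynomials of degree `e` that are, up to a constant, proper powers. -/
def IsProperPowerForm (e : ℕ) (a : MvPolynomial σ F) : Prop :=
  ∃ (k s : ℕ) (v : MvPolynomial σ F) (c : F), 2 ≤ s ∧ k * s = e ∧ v.IsHomogeneous k ∧ c ≠ 0 ∧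
    a = MvPolynomial.C c * v ^ s

/-- Prime multiplicities satisfy `i * v(w) = j * v(a)`, so `i / gcd(i, j)` divides every
multiplicity in `a`. This quotient is at least `2` because `j < i`. -/
lemma exists_associated_pow_of_pow_associated_pow {R : Type*} [CommRing R] [IsDomain R]
    [UniqueFactorizationMonoid R] {a w : R} (ha : a ≠ 0) (hw : w ≠ 0) {i j : ℕ} (hij : j < i)
    (hj : 0 < j) (h : Associated (w ^ i) (a ^ j)) :
    ∃ (s : ℕ) (v : R), 2 ≤ s ∧ Associated a (v ^ s) := by
  classical
  let _ : StrongNormalizationMonoid R := UniqueFactorizationMonoid.strongNormalizationMonoid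
  have hn : i • UniqueFactorizationMonoid.normalizedFactors w =
      j • UniqueFactorizationMonoid.normalizedFactors a := by
    rw [← UniqueFactorizationMonoid.normalizedFactors_pow,
      ← UniqueFactorizationMonoid.normalizedFactors_pow]
    exact (UniqueFactorizationMonoid.associated_iff_normalizedFactors_eq_normalizedFactors
      (pow_ne_zero _ hw) (pow_ne_zero _ ha)).1 h
  set M := UniqueFactorizationMonoid.normalizedFactors a with hM
  have hg : 0 < Nat.gcd i j := Nat.gcd_pos_of_pos_right _ hj
  have hdvd : ∀ x, i / Nat.gcd i j ∣ M.count x := by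
    intro x
    have h1 := congrArg (Multiset.count x) hn
    rw [Multiset.count_nsmul, Multiset.count_nsmul] at h1
    have h2 : i / Nat.gcd i j * Multiset.count x (UniqueFactorizationMonoid.normalizedFactors w) =
        j / Nat.gcd i j * M.count x := by
      refine Nat.eq_of_mul_eq_mul_left hg ?_
      rw [← mul_assoc, ← mul_assoc, Nat.mul_div_cancel' (Nat.gcd_dvd_left _ _),
        Nat.mul_div_cancel' (Nat.gcd_dvd_right _ _), h1]
    exact (Nat.coprime_div_gcd_div_gcd hg).dvd_of_dvd_mul_left (Dvd.intro _ h2)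
  obtain ⟨N, hN⟩ := (Multiset.exists_smul_of_dvd_count M (k := i / Nat.gcd i j)
    (fun x _ => hdvd x))
  refine ⟨i / Nat.gcd i j, N.prod, ?_, ?_⟩
  · have h1 : Nat.gcd i j ≤ j := Nat.gcd_le_right _ hj
    obtain ⟨c, hc⟩ := Nat.gcd_dvd_left i j
    rw [Nat.le_div_iff_mul_le hg]
    have : c ≠ 0 := by rintro rfl; omega
    have : c ≠ 1 := by rintro rfl; omega
    have : 2 ≤ c := by omega
    nlinarith
  · rw [← Multiset.prod_nsmul, ← hN, hM]
    exact (UniqueFactorizationMonoid.prod_normalizedFactors ha).symm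

lemma exists_C_mul_of_associated {a b : MvPolynomial σ F} (h : Associated a b) :
    ∃ c : F, c ≠ 0 ∧ b = MvPolynomial.C c * a := by
  obtain ⟨u, rfl⟩ := h
  have hu := MvPolynomial.isUnit_iff_totalDegree_of_isReduced.1 u.isUnit
  rw [MvPolynomial.totalDegree_eq_zero_iff_eq_C] at hu
  refine ⟨_, hu.1.ne_zero, ?_⟩
  rw [← hu.2, mul_comm]

/-- Since `v` is not assumed homogeneous, it is replaced by its top form; taking top forms is
multiplicative. -/
lemma isProperPowerForm_of_associated_pow {e s : ℕ} {a v : MvPolynomial σ F}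
    (ha : a.IsHomogeneous e) (ha0 : a ≠ 0) (hs : 2 ≤ s) (h : Associated a (v ^ s)) :
    IsProperPowerForm e a := by
  obtain ⟨c, hc, h⟩ := exists_C_mul_of_associated h.symm
  have hdeg : a.totalDegree = v.totalDegree * s := by
    rw [h, ← natDegree_gradingHom, map_mul, map_pow, Polynomial.natDegree_mul,
      Polynomial.natDegree_pow, natDegree_gradingHom, natDegree_gradingHom,
      MvPolynomial.totalDegree_C, zero_add, mul_comm]
    · rw [Ne, map_eq_zero_iff _ gradingHom_injective]; simpa using hc
    · refine pow_ne_zero _ ?_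
      rw [Ne, map_eq_zero_iff _ gradingHom_injective]
      rintro rfl
      rw [zero_pow (by omega), mul_zero] at h
      exact ha0 h
  have hae := ha.totalDegree ha0
  refine ⟨v.totalDegree, s, MvPolynomial.homogeneousComponent v.totalDegree v, c, hs,
    hdeg.symm.trans hae, MvPolynomial.homogeneousComponent_isHomogeneous _ _, hc, ?_⟩
  have h1 := congrArg (fun p => (gradingHom σ F p).leadingCoeff) h
  simp only [map_mul, map_pow, Polynomial.leadingCoeff_mul, Polynomial.leadingCoeff_pow] at h1
  rw [leadingCoeff_gradingHom, leadingCoeff_gradingHom, leadingCoeff_gradingHom,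
    MvPolynomial.totalDegree_C, MvPolynomial.homogeneousComponent_zero,
    MvPolynomial.coeff_zero_C, hae, MvPolynomial.homogeneousComponent_eq_self ha] at h1
  exact h1

lemma homogeneousComponent_aeval_polynomial {g : Polynomial F} {h : MvPolynomial σ F}
    (hg : g.Monic) (hh : 1 ≤ h.totalDegree) :
    MvPolynomial.homogeneousComponent (g.natDegree * h.totalDegree) (Polynomial.aeval h g) =
      MvPolynomial.homogeneousComponent h.totalDegree h ^ g.natDegree := by
  have := leadingCoeff_aeval_polynomial g (gradingHom σ F h)
    (by rw [natDegree_gradingHom]; omega)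
  rw [← gradingHom_aeval, leadingCoeff_gradingHom, leadingCoeff_gradingHom, hg.leadingCoeff,
    map_one, one_mul, totalDegree_aeval_polynomial] at this
  exact this

/-- Two inner components of the same degree have the same top form, up to a root of unity. -/
lemma exists_homogeneousComponent_eq_C_mul {d e : ℕ} {g g' : Polynomial F}
    {h h' : MvPolynomial σ F} (hd : 1 ≤ d) (he : 1 ≤ e) (hg : g.Monic) (hg' : g'.Monic)
    (hgd : g.natDegree = d) (hgd' : g'.natDegree = d) (hh : h.totalDegree = e)
    (hh' : h'.totalDegree = e) (heq : Polynomial.aeval h g = Polynomial.aeval h' g') :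
    ∃ ζ : F, ζ ≠ 0 ∧ ζ ^ d = 1 ∧ MvPolynomial.homogeneousComponent e h' =
      MvPolynomial.C ζ * MvPolynomial.homogeneousComponent e h := by
  have h1 := homogeneousComponent_aeval_polynomial (h := h) hg (by omega)
  have h2 := homogeneousComponent_aeval_polynomial (h := h') hg' (by omega)
  rw [hgd, hh] at h1
  rw [hgd', hh', ← heq, h1] at h2
  have ha : MvPolynomial.homogeneousComponent e h ≠ 0 := by
    rw [← hh]
    refine homogeneousComponent_totalDegree_ne_zero ?_
    rintro rfl
    simp at hh; omega
  -- The `d`-th powers of the two top forms agree. In an integrally closed domain divisibility of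
  -- `d`-th powers descends, so the top forms are associated.
  obtain ⟨ζ, hζ, hζa⟩ := exists_C_mul_of_associated
    (associated_of_dvd_dvd ((IsIntegrallyClosed.pow_dvd_pow_iff (by omega)).1 h2.dvd)
      ((IsIntegrallyClosed.pow_dvd_pow_iff (by omega)).1 h2.symm.dvd))
  refine ⟨ζ, hζ, ?_, hζa⟩
  rw [hζa, mul_pow] at h2
  have h3 := mul_right_cancel₀ (pow_ne_zero _ ha) ((one_mul _).trans h2)
  rw [← map_pow, ← map_one MvPolynomial.C] at h3
  exact (MvPolynomial.C_injective _ _ h3).symm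

lemma aeval_polynomial_injective {h : MvPolynomial σ F} (hh : 1 ≤ h.totalDegree) :
    Function.Injective (Polynomial.aeval h : Polynomial F → MvPolynomial σ F) := by
  intro g g' heq
  have h0 : Polynomial.aeval h (g - g') = 0 := by rw [map_sub]; exact sub_eq_zero.2 heq
  have h1 := totalDegree_aeval_polynomial (g - g') h
  rw [h0, MvPolynomial.totalDegree_zero, eq_comm, mul_eq_zero] at h1
  rw [Polynomial.eq_C_of_natDegree_eq_zero (h1.resolve_right (by omega)), Polynomial.aeval_C] at h0
  have h2 := (map_eq_zero _).1 h0
  rw [← sub_eq_zero, Polynomial.eq_C_of_natDegree_eq_zero (h1.resolve_right (by omega)), h2,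
    Polynomial.C_0]

lemma eq_of_monic_of_eq_C_mul {mo : MonomialOrder σ} {h h' : MvPolynomial σ F} (hh : mo.Monic h)
    (hh' : mo.Monic h') {ζ : F} (heq : h' = MvPolynomial.C ζ * h) : h = h' := by
  have h1 := congrArg mo.leadingCoeff heq
  rw [mo.leadingCoeff_mul, mo.leadingCoeff_C, hh.leadingCoeff_eq_one, hh'.leadingCoeff_eq_one,
    mul_one] at h1
  rw [heq, ← h1, MvPolynomial.C_1, one_mul]

/-- Decompositions with a linear inner component are unique. -/
lemma decomposition_unique_of_totalDegree_eq_one {mo : MonomialOrder σ} {d : ℕ}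
    {g g' : Polynomial F}
    {h h' : MvPolynomial σ F} (hd : 1 ≤ d) (hg : g.Monic) (hg' : g'.Monic)
    (hgd : g.natDegree = d) (hgd' : g'.natDegree = d) (hm : mo.Monic h) (hm' : mo.Monic h')
    (hh : h.totalDegree = 1) (hh' : h'.totalDegree = 1) (h0 : h.coeff 0 = 0)
    (h0' : h'.coeff 0 = 0) (heq : Polynomial.aeval h g = Polynomial.aeval h' g') :
    g = g' ∧ h = h' := by
  have htop : ∀ f : MvPolynomial σ F, f.totalDegree = 1 → f.coeff 0 = 0 →
      MvPolynomial.homogeneousComponent 1 f = f := by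
    intro f hf hf0
    have := MvPolynomial.sum_homogeneousComponent f
    rw [hf, Finset.sum_range_succ, Finset.sum_range_one, MvPolynomial.homogeneousComponent_zero,
      hf0, MvPolynomial.C_0, zero_add] at this
    exact this
  obtain ⟨ζ, -, -, hζ⟩ := exists_homogeneousComponent_eq_C_mul hd le_rfl hg hg' hgd hgd' hh hh' heq
  rw [htop _ hh h0, htop _ hh' h0'] at hζ
  have hhh := eq_of_monic_of_eq_C_mul hm hm' hζ
  refine ⟨aeval_polynomial_injective hh.ge ?_, hhh⟩
  rw [heq, ← hhh]

/-- Decompositions with an outer component of prime degree are unique, if the top form of the inner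
component is not a proper power. -/
lemma decomposition_unique_of_prime {mo : MonomialOrder σ} {d e : ℕ} {g g' : Polynomial F}
    {h h' : MvPolynomial σ F} (hd : d.Prime) (he : 1 ≤ e) (hg : g.Monic) (hg' : g'.Monic)
    (hgd : g.natDegree = d) (hgd' : g'.natDegree = d) (hm : mo.Monic h) (hm' : mo.Monic h')
    (hh : h.totalDegree = e) (hh' : h'.totalDegree = e) (h0 : h.coeff 0 = 0)
    (h0' : h'.coeff 0 = 0) (hpow : ¬ IsProperPowerForm e (MvPolynomial.homogeneousComponent e h))
    (heq : Polynomial.aeval h g = Polynomial.aeval h' g') :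
    g = g' ∧ h = h' := by
  obtain ⟨ζ, hζ0, hζd, hζ⟩ :=
    exists_homogeneousComponent_eq_C_mul hd.one_lt.le he hg hg' hgd hgd' hh hh' heq
  set a := MvPolynomial.homogeneousComponent e h with ha
  have ha0 : a ≠ 0 := by
    rw [ha, ← hh]
    refine homogeneousComponent_totalDegree_ne_zero ?_
    rintro rfl
    simp at hh; omega
  have hCC : MvPolynomial.C ζ⁻¹ * MvPolynomial.C ζ = (1 : MvPolynomial σ F) := by
    rw [← map_mul, inv_mul_cancel₀ hζ0, map_one]
  have hX1 : (Polynomial.C ζ * Polynomial.X : Polynomial F).natDegree = 1 :=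
    Polynomial.natDegree_C_mul_X _ hζ0
  -- Rescaling gives both inner components the top form `a`. The new outer component stays monic
  -- because `ζ ^ d = 1`; `h''` need not be monic.
  set h'' := MvPolynomial.C ζ⁻¹ * h' with hh''
  set g'' := g'.comp (Polynomial.C ζ * Polynomial.X) with hg''
  have hgm'' : g''.Monic := by
    rw [Polynomial.Monic, hg'', Polynomial.leadingCoeff_comp (by rw [hX1]; exact one_ne_zero),
      hg'.leadingCoeff, Polynomial.leadingCoeff_C_mul_X, hgd', hζd, one_mul]
  have hgd'' : g''.natDegree = d := by
    rw [hg'', Polynomial.natDegree_comp, hX1, hgd', mul_one]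
  have hcomp : Polynomial.aeval h'' g'' = Polynomial.aeval h' g' := by
    rw [hg'', Polynomial.aeval_comp, map_mul, Polynomial.aeval_C, Polynomial.aeval_X, hh'',
      MvPolynomial.algebraMap_eq, ← mul_assoc, mul_comm (MvPolynomial.C ζ), hCC, one_mul]
  have hd'' : h''.totalDegree = e := by
    rw [hh'', ← hh']
    refine le_antisymm ?_ ?_
    · refine (MvPolynomial.totalDegree_mul _ _).trans ?_
      rw [MvPolynomial.totalDegree_C, zero_add]
    · conv_lhs => rw [← one_mul h', ← hCC, mul_comm (MvPolynomial.C ζ⁻¹), mul_assoc]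
      refine (MvPolynomial.totalDegree_mul _ _).trans ?_
      rw [MvPolynomial.totalDegree_C, zero_add]
  have htop'' : MvPolynomial.homogeneousComponent e h'' = a := by
    rw [hh'', MvPolynomial.homogeneousComponent_C_mul, hζ, ← mul_assoc, hCC, one_mul]
  have hcoeff0 : ∀ f : MvPolynomial σ F, f.coeff 0 = 0 → (gradingHom σ F f).coeff 0 = 0 := by
    intro f hf
    rw [coeff_gradingHom, MvPolynomial.homogeneousComponent_zero, hf, MvPolynomial.C_0]
  rcases eq_or_exists_pow_eq_of_aeval_eq hd hg hgm'' hgd hgd'' (H := gradingHom σ F h)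
    (H' := gradingHom σ F h'') he ha0 (by rw [natDegree_gradingHom, hh])
    (by rw [natDegree_gradingHom, hd'']) (by rw [leadingCoeff_gradingHom, hh])
    (by rw [leadingCoeff_gradingHom, hd'', htop'']) (hcoeff0 _ h0)
    (hcoeff0 _ (by rw [hh'', MvPolynomial.coeff_C_mul, h0', mul_zero]))
    (by rw [← gradingHom_aeval, ← gradingHom_aeval, hcomp, heq]) with h1 | h1
  · have h2 := gradingHom_injective h1
    have hhh : h = h' := by
      refine eq_of_monic_of_eq_C_mul hm hm' (ζ := ζ) ?_
      rw [h2, hh'', ← mul_assoc, mul_comm (MvPolynomial.C ζ), hCC, one_mul]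
    refine ⟨aeval_polynomial_injective (hh ▸ he) ?_, hhh⟩
    rw [heq, ← hhh]
  · obtain ⟨t, i, j, w, c, ht, hte, hi, hij, hc, hw⟩ := h1
    exfalso
    have hj : 0 < j := by
      rcases Nat.eq_zero_or_pos j with rfl | h
      · rw [zero_mul] at hij
        exact absurd hij (Nat.mul_pos hi ht).ne'
      · exact h
    -- `i * t = j * e` with `t < e`.
    have hji : j < i := by
      by_contra hle
      have h3 : i * t ≤ j * t := Nat.mul_le_mul_right _ (not_lt.1 hle)
      have h4 : j * t < j * e := Nat.mul_lt_mul_of_pos_left hte hj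
      omega
    have hcu : IsUnit (MvPolynomial.C c : MvPolynomial σ F) := hc.isUnit.map MvPolynomial.C
    have hassoc : Associated (w ^ i) (a ^ j) := by
      rw [hw, MvPolynomial.algebraMap_eq]
      exact associated_unit_mul_left _ _ hcu
    have hw0 : w ≠ 0 := by
      rintro rfl
      rw [zero_pow hi.ne'] at hassoc
      exact pow_ne_zero j ha0 ((associated_zero_iff_eq_zero _).1 hassoc.symm)
    obtain ⟨s, v, hs, hv⟩ := exists_associated_pow_of_pow_associated_pow ha0 hw0 hji hj hassoc
    exact hpow (isProperPowerForm_of_associated_pow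
      (MvPolynomial.homogeneousComponent_isHomogeneous _ _) ha0 hs hv)

end Grading

/-! ### Counting forms, inner components and outer components -/

section Counting

variable {r : ℕ} {F : Type*} [Field F]

/-- The polynomials supported on monomials of degree strictly between `0` and `e`. -/
def lowerPolys (r e : ℕ) (F : Type*) [Field F] : Set (MvPolynomial (Fin r) F) :=
  {u | ∀ s ∈ u.support, 0 < s.degree ∧ s.degree < e}

/-- The nonzero homogeneous polynomials of degree `e`. -/
def nonzeroForms (r e : ℕ) (F : Type*) [Field F] : Set (MvPolynomial (Fin r) F) :=
  {a | a.IsHomogeneous e ∧ a ≠ 0}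

/-- The monic polynomials of degree `e` vanishing at the origin with top form in `B`. -/
def monicWithTop (mo : MonomialOrder (Fin r)) (e : ℕ) (B : Set (MvPolynomial (Fin r) F)) :
    Set (MvPolynomial (Fin r) F) :=
  {h | mo.Monic h ∧ h.totalDegree = e ∧ h.coeff 0 = 0 ∧
    MvPolynomial.homogeneousComponent e h ∈ B}

/-- The monic univariate polynomials of degree `d` vanishing at `0`. -/
def monicUnivariate (d : ℕ) (F : Type*) [Field F] : Set (Polynomial F) :=
  {g | g.Monic ∧ g.natDegree = d ∧ g.coeff 0 = 0}

lemma ncard_restrictSupport {σ : Type*} [Fintype F] (T : Finset (σ →₀ ℕ)) :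
    {f : MvPolynomial σ F | ∀ s ∈ f.support, s ∈ T}.ncard = Fintype.card F ^ T.card := by
  let b := MvPolynomial.basisRestrictSupport F (T : Set (σ →₀ ℕ))
  have _ := Module.Finite.of_basis b
  have h1 := Module.natCard_eq_pow_finrank (K := F)
    (V := MvPolynomial.restrictSupport F (T : Set (σ →₀ ℕ)))
  rw [Module.finrank_eq_card_basis b] at h1
  simp only [Finset.coe_sort_coe, Fintype.card_coe, Nat.card_eq_fintype_card (α := F)] at h1
  exact h1

lemma card_finsupp_degree (hr : 1 ≤ r) (k : ℕ) :
    ((Finset.univ : Finset (Fin r)).finsuppAntidiag k).card = (r - 1 + k).choose (r - 1) := by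
  rw [Finset.card_finsuppAntidiag_nat_eq_choose, Finset.card_univ, Fintype.card_fin,
    ← Nat.choose_symm_of_eq_add (n := r + k - 1) (a := r - 1) (b := k) (by omega)]
  congr 1; omega

lemma mem_univ_finsuppAntidiag {k : ℕ} {s : Fin r →₀ ℕ} :
    s ∈ (Finset.univ : Finset (Fin r)).finsuppAntidiag k ↔ s.degree = k := by
  rw [Finset.mem_finsuppAntidiag, Finsupp.degree_eq_sum]
  simp

lemma isHomogeneous_iff_degree {f : MvPolynomial (Fin r) F} {k : ℕ} :
    f.IsHomogeneous k ↔ ∀ s ∈ f.support, s.degree = k := by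
  rw [← MvPolynomial.mem_homogeneousSubmodule, MvPolynomial.homogeneousSubmodule_eq_finsupp_supported]
  rfl

lemma sum_choose_degree (hr : 1 ≤ r) {e : ℕ} (he : 1 ≤ e) :
    ∑ k ∈ Finset.range e, (r - 1 + k).choose (r - 1) = (r - 1 + e).choose r := by
  obtain ⟨r, rfl⟩ : ∃ r', r = r' + 1 := ⟨r - 1, by omega⟩
  obtain ⟨e, rfl⟩ : ∃ e', e = e' + 1 := ⟨e - 1, by omega⟩
  have := Nat.sum_range_add_choose e r
  simp only [Nat.add_sub_cancel]
  rw [show r + (e + 1) = e + r + 1 by ring, ← this]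
  exact Finset.sum_congr rfl fun k _ => by rw [add_comm]

lemma ncard_homForms [Fintype F] (hr : 1 ≤ r) (k : ℕ) :
    {f : MvPolynomial (Fin r) F | f.IsHomogeneous k}.ncard =
      Fintype.card F ^ (r - 1 + k).choose (r - 1) := by
  rw [← card_finsupp_degree hr, ← ncard_restrictSupport]
  congr 1
  ext f
  simp only [Set.mem_ofPred_eq, isHomogeneous_iff_degree, mem_univ_finsuppAntidiag]

lemma homForms_finite [Fintype F] (hr : 1 ≤ r) (k : ℕ) :
    {f : MvPolynomial (Fin r) F | f.IsHomogeneous k}.Finite := by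
  refine Set.finite_of_ncard_pos ?_
  rw [ncard_homForms hr]
  exact Nat.pow_pos Fintype.card_pos

lemma ncard_nonzeroForms [Fintype F] (hr : 1 ≤ r) (k : ℕ) :
    (nonzeroForms r k F).ncard = Fintype.card F ^ (r - 1 + k).choose (r - 1) - 1 := by
  rw [← ncard_homForms hr, ← Set.ncard_sdiff_singleton_of_mem (a := 0)]
  · congr 1
  · exact MvPolynomial.isHomogeneous_zero _ _ _

lemma ncard_lowerPolys [Fintype F] (hr : 1 ≤ r) {e : ℕ} (he : 1 ≤ e) :
    (lowerPolys r e F).ncard = Fintype.card F ^ ((r - 1 + e).choose r - 1) := by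
  classical
  have h1 : lowerPolys r e F = {f | ∀ s ∈ f.support, s ∈
      (Finset.Ico 1 e).biUnion fun k => (Finset.univ : Finset (Fin r)).finsuppAntidiag k} := by
    ext f
    simp only [lowerPolys, Set.mem_ofPred_eq, Finset.mem_biUnion, mem_univ_finsuppAntidiag,
      Finset.mem_Ico, Nat.succ_le_iff, exists_eq_right']
  rw [h1, ncard_restrictSupport, Finset.card_biUnion, ← sum_choose_degree hr he,
    Finset.range_eq_Ico, Finset.sum_eq_sum_Ico_succ_bot (a := 0) (b := e) (by omega)]
  · congr 1
    rw [Finset.sum_congr rfl fun k _ => card_finsupp_degree hr k]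
    simp
  · intro i _ j _ hij
    rw [Function.onFun, Finset.disjoint_left]
    intro s hs hs'
    rw [mem_univ_finsuppAntidiag] at hs hs'
    exact hij (hs.symm.trans hs')

/-- Every nonzero polynomial is a unique constant multiple of a monic one. -/
lemma ncard_eq_mul_ncard_monic [Fintype F] (mo : MonomialOrder (Fin r))
    (S : Set (MvPolynomial (Fin r) F)) (h0 : 0 ∉ S)
    (hS : ∀ c : F, c ≠ 0 → ∀ f ∈ S, MvPolynomial.C c * f ∈ S) :
    S.ncard = (Fintype.card F - 1) * {f ∈ S | mo.Monic f}.ncard := by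
  have himg : S = (fun p : F × MvPolynomial (Fin r) F => MvPolynomial.C p.1 * p.2) ''
      ({(0 : F)}ᶜ ×ˢ {f ∈ S | mo.Monic f}) := by
    ext f
    constructor
    · intro hf
      have hf0 : mo.leadingCoeff f ≠ 0 := by
        rw [Ne, mo.leadingCoeff_eq_zero_iff]; rintro rfl; exact h0 hf
      refine ⟨(mo.leadingCoeff f, MvPolynomial.C (mo.leadingCoeff f)⁻¹ * f),
        ⟨hf0, hS _ (inv_ne_zero hf0) _ hf, ?_⟩, ?_⟩
      · rw [MonomialOrder.Monic, mo.leadingCoeff_mul, mo.leadingCoeff_C, inv_mul_cancel₀ hf0]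
      · simp only
        rw [← mul_assoc, ← map_mul, mul_inv_cancel₀ hf0, map_one, one_mul]
    · rintro ⟨⟨c, f⟩, ⟨hc, hf, -⟩, rfl⟩
      exact hS c hc f hf
  have hinj : Set.InjOn (fun p : F × MvPolynomial (Fin r) F => MvPolynomial.C p.1 * p.2)
      ({(0 : F)}ᶜ ×ˢ {f ∈ S | mo.Monic f}) := by
    rintro ⟨c, f⟩ ⟨hc, -, hf⟩ ⟨c', f'⟩ ⟨hc', -, hf'⟩ h
    simp only at h hf hf'
    have h1 := congrArg mo.leadingCoeff h
    rw [mo.leadingCoeff_mul, mo.leadingCoeff_mul, mo.leadingCoeff_C, mo.leadingCoeff_C,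
      hf.leadingCoeff_eq_one, hf'.leadingCoeff_eq_one, mul_one, mul_one] at h1
    subst h1
    have hC : (MvPolynomial.C c : MvPolynomial (Fin r) F) ≠ 0 := by simpa using hc
    rw [mul_left_cancel₀ hC h]
  conv_lhs => rw [himg]
  rw [hinj.ncard_image, Set.ncard_prod, Set.ncard_compl, Set.ncard_singleton,
    Nat.card_eq_fintype_card]

lemma homogeneousComponent_eq_zero_of_mem_lowerPolys {e : ℕ} {u : MvPolynomial (Fin r) F}
    (hu : u ∈ lowerPolys r e F) : MvPolynomial.homogeneousComponent e u = 0 := by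
  refine MvPolynomial.homogeneousComponent_eq_zero' _ _ fun s hs => ?_
  exact (hu s hs).2.ne

lemma setOf_top_mem_eq_image {e : ℕ} (he : 1 ≤ e) {B : Set (MvPolynomial (Fin r) F)}
    (hB : B ⊆ nonzeroForms r e F) :
    {h : MvPolynomial (Fin r) F | h.totalDegree = e ∧ h.coeff 0 = 0 ∧
      MvPolynomial.homogeneousComponent e h ∈ B} =
    (fun p : MvPolynomial (Fin r) F × MvPolynomial (Fin r) F => p.1 + p.2) ''
      (B ×ˢ lowerPolys r e F) := by
  classical
  ext f
  constructor
  · rintro ⟨hfd, hf0, hfB⟩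
    refine ⟨(MvPolynomial.homogeneousComponent e f, f - MvPolynomial.homogeneousComponent e f),
      ⟨hfB, ?_⟩, by simp⟩
    intro s hs
    rw [MvPolynomial.mem_support_iff, MvPolynomial.coeff_sub,
      MvPolynomial.coeff_homogeneousComponent] at hs
    have hse : s.degree ≠ e := by
      intro h; rw [if_pos h, sub_self] at hs; exact hs rfl
    rw [if_neg hse, sub_zero] at hs
    have hle := MvPolynomial.le_totalDegree (MvPolynomial.mem_support_iff.2 hs)
    rw [hfd] at hle
    have hle' : s.degree ≤ e := hle
    refine ⟨?_, lt_of_le_of_ne hle' hse⟩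
    rw [Nat.pos_iff_ne_zero, Ne, Finsupp.degree_eq_zero_iff]
    rintro rfl
    exact hs hf0
  · rintro ⟨⟨b, u⟩, ⟨hb, hu⟩, rfl⟩
    simp only at hb hu ⊢
    have hhc : MvPolynomial.homogeneousComponent e (b + u) = b := by
      rw [map_add, homogeneousComponent_eq_zero_of_mem_lowerPolys hu, add_zero,
        MvPolynomial.homogeneousComponent_eq_self (hB hb).1]
    refine ⟨le_antisymm ?_ ?_, ?_, hhc.symm ▸ hb⟩
    · refine (MvPolynomial.totalDegree_add _ _).trans (max_le (hB hb).1.totalDegree_le ?_)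
      exact Finset.sup_le fun s hs => (hu s hs).2.le
    · by_contra h
      rw [MvPolynomial.homogeneousComponent_eq_zero _ _ (not_le.1 h)] at hhc
      exact (hB hb).2 hhc.symm
    · rw [MvPolynomial.coeff_add, (hB hb).1.coeff_eq_zero (by rw [map_zero]; omega), zero_add]
      by_contra h
      have := (hu 0 (MvPolynomial.mem_support_iff.2 h)).1
      simp at this

/-- For a general monomial order the leading monomial need not lie in the top form, so monic
polynomials are not counted directly. Dropping monicity multiplies the count by `q - 1`, after which
top form and lower part are independent. -/
lemma ncard_monicWithTop [Fintype F] (mo : MonomialOrder (Fin r)) (hr : 1 ≤ r) {e : ℕ}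
    (he : 1 ≤ e) {B : Set (MvPolynomial (Fin r) F)} (hB : B ⊆ nonzeroForms r e F)
    (hBC : ∀ c : F, c ≠ 0 → ∀ f ∈ B, MvPolynomial.C c * f ∈ B) :
    (Fintype.card F - 1) * (monicWithTop mo e B).ncard =
      B.ncard * Fintype.card F ^ ((r - 1 + e).choose r - 1) := by
  have h1 := setOf_top_mem_eq_image he hB
  set P := {h : MvPolynomial (Fin r) F | h.totalDegree = e ∧ h.coeff 0 = 0 ∧
      MvPolynomial.homogeneousComponent e h ∈ B} with hP
  have h2 : monicWithTop mo e B = {f ∈ P | mo.Monic f} := by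
    ext f; simp only [monicWithTop, hP, Set.mem_ofPred_eq]; tauto
  rw [h2, ← ncard_eq_mul_ncard_monic mo, h1, Set.InjOn.ncard_image, Set.ncard_prod,
    ncard_lowerPolys hr he]
  · rintro ⟨b, u⟩ ⟨hb, hu⟩ ⟨b', u'⟩ ⟨hb', hu'⟩ h
    simp only at hb hu hb' hu' h
    have h3 := congrArg (MvPolynomial.homogeneousComponent e) h
    rw [map_add, map_add, homogeneousComponent_eq_zero_of_mem_lowerPolys hu,
      homogeneousComponent_eq_zero_of_mem_lowerPolys hu', add_zero, add_zero,
      MvPolynomial.homogeneousComponent_eq_self (hB hb).1,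
      MvPolynomial.homogeneousComponent_eq_self (hB hb').1] at h3
    subst h3
    rw [add_left_cancel h]
  · rintro ⟨h, -⟩
    rw [MvPolynomial.totalDegree_zero] at h; omega
  · rintro c hc f ⟨hf, hf0, hfB⟩
    refine ⟨?_, ?_, ?_⟩
    · rw [MvPolynomial.totalDegree_mul_of_isDomain, MvPolynomial.totalDegree_C, zero_add, hf]
      · simpa using hc
      · rintro rfl; rw [MvPolynomial.totalDegree_zero] at hf; omega
    · rw [MvPolynomial.coeff_C_mul, hf0, mul_zero]
    · rw [MvPolynomial.homogeneousComponent_C_mul]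
      exact hBC c hc _ hfB

lemma ncard_monicUnivariate [Fintype F] {d : ℕ} (hd : 1 ≤ d) :
    (monicUnivariate d F).ncard = Fintype.card F ^ (d - 1) := by
  have h1 : monicUnivariate d F = (fun u : Polynomial F => Polynomial.X ^ d + Polynomial.X * u) ''
      (Polynomial.degreeLT F (d - 1) : Set (Polynomial F)) := by
    ext g
    constructor
    · rintro ⟨hg, hgd, hg0⟩
      obtain ⟨u, hu⟩ := Polynomial.X_dvd_iff.2
        (show Polynomial.coeff (g - Polynomial.X ^ d) 0 = 0 by
          rw [Polynomial.coeff_sub, hg0, Polynomial.coeff_X_pow, if_neg (by omega), sub_zero])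
      refine ⟨u, ?_, ?_⟩
      · rw [SetLike.mem_coe, Polynomial.mem_degreeLT, Polynomial.degree_lt_iff_coeff_zero]
        intro m hm
        rw [← Polynomial.coeff_X_mul, ← hu, Polynomial.coeff_sub, Polynomial.coeff_X_pow]
        rcases Nat.lt_or_ge d (m + 1) with h | h
        · rw [if_neg (by omega), sub_zero, Polynomial.coeff_eq_zero_of_natDegree_lt (by omega)]
        · have : m + 1 = d := by omega
          rw [if_pos this, this, ← hgd, hg.coeff_natDegree, sub_self]
      · simp only
        rw [← hu]; ring
    · rintro ⟨u, hu, rfl⟩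
      rw [SetLike.mem_coe, Polynomial.mem_degreeLT] at hu
      have hdeg : (Polynomial.X * u).degree < (d : WithBot ℕ) := by
        rw [Polynomial.degree_lt_iff_coeff_zero] at hu ⊢
        intro m hm
        obtain ⟨m, rfl⟩ : ∃ m', m = m' + 1 := ⟨m - 1, by omega⟩
        rw [Polynomial.coeff_X_mul]
        exact hu m (by omega)
      refine ⟨Polynomial.monic_X_pow_add hdeg, ?_, ?_⟩
      · exact Polynomial.natDegree_eq_of_degree_eq_some
          ((Polynomial.degree_add_eq_left_of_degree_lt
            (by rwa [Polynomial.degree_X_pow])).trans (Polynomial.degree_X_pow d))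
      · simp [Polynomial.coeff_X_pow]
        omega
  rw [h1, Set.InjOn.ncard_image]
  · have h2 := Nat.card_congr (Polynomial.degreeLTEquiv F (d - 1)).toEquiv
    rw [Nat.card_eq_fintype_card (α := Fin (d - 1) → F), Fintype.card_fun, Fintype.card_fin] at h2
    exact h2
  · intro u _ v _ h
    exact mul_left_cancel₀ Polynomial.X_ne_zero (add_left_cancel h)

end Counting

/-! ### Compositions, decomposable polynomials and power forms -/

section Decomposable

variable {r : ℕ} {F : Type*} [Field F]

lemma monic_add_C {mo : MonomialOrder (Fin r)} {f : MvPolynomial (Fin r) F} (hf : mo.Monic f)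
    (hd : f.totalDegree ≠ 0) (c : F) : mo.Monic (f + MvPolynomial.C c) := by
  refine hf.add_of_lt ?_
  rw [mo.degree_C, map_zero]
  refine mo.toSyn_lt_iff_ne_zero.2 ?_
  rwa [Ne, EmbeddingLike.map_eq_zero_iff, mo.degree_eq_zero_iff_totalDegree_eq_zero]

lemma totalDegree_add_C {f : MvPolynomial (Fin r) F} (c : F) :
    (f + MvPolynomial.C c).totalDegree = f.totalDegree := by
  have h : ∀ (f : MvPolynomial (Fin r) F) (c : F),
      (f + MvPolynomial.C c).totalDegree ≤ f.totalDegree := fun f c => by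
    refine (MvPolynomial.totalDegree_add _ _).trans ?_
    rw [MvPolynomial.totalDegree_C]; simp
  refine le_antisymm (h _ _) ?_
  have := h (f + MvPolynomial.C c) (-c)
  rwa [add_assoc, ← map_add, add_neg_cancel, map_zero, add_zero] at this

/-- Horner's scheme: `g = X * divX g + c`, and adding a constant to a nonconstant polynomial keeps
its leading term. -/
lemma monic_aeval_polynomial {mo : MonomialOrder (Fin r)} {h : MvPolynomial (Fin r) F}
    (hm : mo.Monic h) (hh : 1 ≤ h.totalDegree) (d : ℕ) : ∀ {g : Polynomial F}, g.Monic →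
    g.natDegree = d → mo.Monic (Polynomial.aeval h g) := by
  induction d with
  | zero =>
    intro g hg hd
    rw [hg.natDegree_eq_zero.1 hd, map_one]
    exact mo.monic_one
  | succ d ih =>
    intro g hg hd
    have hdeg : g.divX.natDegree = d := by rw [Polynomial.natDegree_divX_eq_natDegree_tsub_one, hd]; rfl
    have hmon : g.divX.Monic := by
      rw [Polynomial.Monic, Polynomial.leadingCoeff, hdeg, Polynomial.coeff_divX, ← hd]
      exact hg
    have hm' := (ih hmon hdeg).mul hm
    rw [← Polynomial.divX_mul_X_add g, map_add, map_mul, Polynomial.aeval_X, Polynomial.aeval_C]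
    refine monic_add_C hm' ?_ _
    rw [MvPolynomial.totalDegree_mul_of_isDomain (ih hmon hdeg).ne_zero hm.ne_zero]
    omega

lemma coeff_zero_aeval_polynomial (g : Polynomial F) (h : MvPolynomial (Fin r) F) :
    (Polynomial.aeval h g).coeff 0 = g.eval (h.coeff 0) := by
  have := Polynomial.hom_eval₂ g (algebraMap F (MvPolynomial (Fin r) F))
    MvPolynomial.constantCoeff h
  rw [← Polynomial.aeval_def, MvPolynomial.constantCoeff_eq] at this
  rw [this, Polynomial.eval₂_eq_eval_map]
  congr 1
  convert Polynomial.map_id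
  ext; simp

lemma mem_monicWithTop_nonzeroForms {mo : MonomialOrder (Fin r)} {e : ℕ} {h : MvPolynomial (Fin r) F} :
    h ∈ monicWithTop mo e (nonzeroForms r e F) ↔
      mo.Monic h ∧ h.totalDegree = e ∧ h.coeff 0 = 0 := by
  constructor
  · rintro ⟨h1, h2, h3, -⟩
    exact ⟨h1, h2, h3⟩
  · rintro ⟨h1, h2, h3⟩
    exact ⟨h1, h2, h3, MvPolynomial.homogeneousComponent_isHomogeneous _ _,
      h2 ▸ homogeneousComponent_totalDegree_ne_zero h1.ne_zero⟩

/-- The compositions `g(h)` with `deg g = d`, `deg h = e`, both vanishing at the origin, where the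
top form of `h` lies in `B`. -/
def compositions (mo : MonomialOrder (Fin r)) (d e : ℕ) (B : Set (MvPolynomial (Fin r) F)) :
    Set (MvPolynomial (Fin r) F) :=
  (fun p : Polynomial F × MvPolynomial (Fin r) F => Polynomial.aeval p.2 p.1) ''
    (monicUnivariate d F ×ˢ monicWithTop mo e B)

lemma compositions_subset {mo : MonomialOrder (Fin r)} {d e n : ℕ} (hd : 2 ≤ d) (he : 1 ≤ e)
    (hn : d * e = n) (B : Set (MvPolynomial (Fin r) F)) :
    compositions mo d e B ⊆ decomposablePolys mo n F := by
  rintro _ ⟨⟨g, h⟩, ⟨⟨hg, hgd, hg0⟩, ⟨hh, hhd, hh0, -⟩⟩, rfl⟩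
  simp only at hg hgd hg0 hh hhd hh0 ⊢
  refine ⟨⟨?_, monic_aeval_polynomial hh (hhd ▸ he) d hg hgd⟩,
    ⟨g, h, hg, hgd ▸ hd, hh, hhd ▸ he, rfl⟩, ?_⟩
  · rw [totalDegree_aeval_polynomial, hgd, hhd, hn]
  · rw [MvPolynomial.eval_zero, MvPolynomial.constantCoeff_eq, coeff_zero_aeval_polynomial, hh0,
      ← Polynomial.coeff_zero_eq_eval_zero, hg0]

lemma decomposablePolys_subset {mo : MonomialOrder (Fin r)} {n : ℕ} (hn : n ≠ 0) :
    decomposablePolys mo n F ⊆ ⋃ d ∈ n.divisors.filter (2 ≤ ·),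
      compositions mo d (n / d) (nonzeroForms r (n / d) F) := by
  rintro f ⟨⟨hfn, -⟩, ⟨g, h, hg, hgd, hh, hhd, rfl⟩, hf0⟩
  rw [totalDegree_aeval_polynomial] at hfn
  have hdvd : g.natDegree ∣ n := Dvd.intro _ hfn
  simp only [Set.mem_iUnion]
  refine ⟨g.natDegree, Finset.mem_filter.2 ⟨Nat.mem_divisors.2 ⟨hdvd, hn⟩, hgd⟩, ?_⟩
  -- The constant term of `h` is moved into `g`. The new `g` then vanishes at `0` because `f` does.
  have hX1 : (Polynomial.X + Polynomial.C (h.coeff 0)).natDegree = 1 := Polynomial.natDegree_X_add_C _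
  have hcomp : Polynomial.aeval (h + MvPolynomial.C (-h.coeff 0))
      (g.comp (Polynomial.X + Polynomial.C (h.coeff 0))) = Polynomial.aeval h g := by
    rw [Polynomial.aeval_comp, map_add, Polynomial.aeval_X, Polynomial.aeval_C,
      MvPolynomial.algebraMap_eq, map_neg, neg_add_cancel_right]
  have hc0 : (h + MvPolynomial.C (-h.coeff 0)).coeff 0 = 0 := by
    rw [MvPolynomial.coeff_add, MvPolynomial.coeff_zero_C, add_neg_cancel]
  refine ⟨(g.comp (Polynomial.X + Polynomial.C (h.coeff 0)), h + MvPolynomial.C (-h.coeff 0)),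
    ⟨⟨?_, ?_, ?_⟩, mem_monicWithTop_nonzeroForms.2 ⟨monic_add_C hh (by omega) _, ?_, hc0⟩⟩, hcomp⟩
  · exact hg.comp_X_add_C _
  · simp only [Polynomial.natDegree_comp, hX1, mul_one]
  · rw [MvPolynomial.eval_zero, MvPolynomial.constantCoeff_eq, ← hcomp,
      coeff_zero_aeval_polynomial, hc0] at hf0
    rw [Polynomial.coeff_zero_eq_eval_zero]
    exact hf0
  · simp only [totalDegree_add_C]
    rw [← hfn, Nat.mul_div_cancel_left _ (by omega)]

lemma monicWithTop_finite [Fintype F] (mo : MonomialOrder (Fin r)) (hr : 1 ≤ r) {e : ℕ}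
    (he : 1 ≤ e) (B : Set (MvPolynomial (Fin r) F)) : (monicWithTop mo e B).Finite := by
  have hB : (nonzeroForms r e F).Finite := (homForms_finite hr e).subset fun a ha => ha.1
  have hL : (lowerPolys r e F).Finite := by
    refine Set.finite_of_ncard_pos ?_
    rw [ncard_lowerPolys hr he]
    exact Nat.pow_pos Fintype.card_pos
  have h1 := (hB.prod hL).image
    (fun p : MvPolynomial (Fin r) F × MvPolynomial (Fin r) F => p.1 + p.2)
  rw [← setOf_top_mem_eq_image he subset_rfl] at h1
  refine h1.subset ?_
  rintro h ⟨h1, h2, h3, -⟩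
  exact ⟨h2, h3, (mem_monicWithTop_nonzeroForms.2 ⟨h1, h2, h3⟩).2.2.2⟩

lemma monicUnivariate_finite [Fintype F] {d : ℕ} (hd : 1 ≤ d) : (monicUnivariate d F).Finite := by
  refine Set.finite_of_ncard_pos ?_
  rw [ncard_monicUnivariate hd]
  exact Nat.pow_pos Fintype.card_pos

lemma compositions_finite [Fintype F] (mo : MonomialOrder (Fin r)) (hr : 1 ≤ r) {d e : ℕ}
    (hd : 1 ≤ d) (he : 1 ≤ e) (B : Set (MvPolynomial (Fin r) F)) :
    (compositions mo d e B).Finite :=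
  ((monicUnivariate_finite hd).prod (monicWithTop_finite mo hr he B)).image _

lemma ncard_compositions_le [Fintype F] (mo : MonomialOrder (Fin r)) (hr : 1 ≤ r) {d e : ℕ}
    (hd : 1 ≤ d) (he : 1 ≤ e) (B : Set (MvPolynomial (Fin r) F)) :
    (compositions mo d e B).ncard ≤ Fintype.card F ^ (d - 1) * (monicWithTop mo e B).ncard := by
  rw [← ncard_monicUnivariate hd, ← Set.ncard_prod]
  exact Set.ncard_image_le ((monicUnivariate_finite hd).prod (monicWithTop_finite mo hr he B))

lemma div_pos_of_mem_divisors {n d : ℕ} (hd : d ∈ n.divisors) : 1 ≤ n / d :=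
  Nat.div_pos (Nat.divisor_le hd) (Nat.pos_of_mem_divisors hd)

lemma decomposablePolys_finite [Fintype F] (mo : MonomialOrder (Fin r)) (hr : 1 ≤ r) {n : ℕ}
    (hn : n ≠ 0) : (decomposablePolys mo n F).Finite := by
  refine Set.Finite.subset (Set.Finite.biUnion (Finset.finite_toSet _) fun d hd => ?_)
    (decomposablePolys_subset hn)
  have hd' := Finset.mem_filter.1 hd
  exact compositions_finite mo hr (by omega) (div_pos_of_mem_divisors hd'.1) _

lemma ncard_decomposablePolys_le [Fintype F] (mo : MonomialOrder (Fin r)) (hr : 1 ≤ r) {n : ℕ}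
    (hn : n ≠ 0) : (decomposablePolys mo n F).ncard ≤ ∑ d ∈ n.divisors.filter (2 ≤ ·),
      Fintype.card F ^ (d - 1) * (monicWithTop mo (n / d) (nonzeroForms r (n / d) F)).ncard := by
  have hfin : ∀ d ∈ n.divisors.filter (2 ≤ ·),
      (compositions mo d (n / d) (nonzeroForms r (n / d) F)).Finite := fun d hd => by
    have hd' := Finset.mem_filter.1 hd
    exact compositions_finite mo hr (by omega) (div_pos_of_mem_divisors hd'.1) _
  refine (Set.ncard_le_ncard (decomposablePolys_subset hn)
    (Set.Finite.biUnion (Finset.finite_toSet _) hfin)).trans ?_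
  refine (Finset.set_ncard_biUnion_le _ _).trans (Finset.sum_le_sum fun d hd => ?_)
  have hd' := Finset.mem_filter.1 hd
  exact ncard_compositions_le mo hr (by omega) (div_pos_of_mem_divisors hd'.1) _

/-- Compositions with a linear inner component are counted without collisions. -/
lemma le_ncard_decomposablePolys_linear [Fintype F] (mo : MonomialOrder (Fin r)) (hr : 1 ≤ r)
    {n : ℕ} (hn : 2 ≤ n) :
    Fintype.card F ^ (n - 1) * (monicWithTop mo 1 (nonzeroForms r 1 F)).ncard ≤
      (decomposablePolys mo n F).ncard := by
  refine le_trans (le_of_eq ?_) (Set.ncard_le_ncard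
    (compositions_subset hn le_rfl (mul_one n) (nonzeroForms r 1 F))
    (decomposablePolys_finite mo hr (by omega)))
  rw [compositions, Set.InjOn.ncard_image, Set.ncard_prod, ncard_monicUnivariate (by omega)]
  rintro ⟨g, h⟩ ⟨⟨hg, hgd, -⟩, ⟨hh, hhd, hh0, -⟩⟩ ⟨g', h'⟩ ⟨⟨hg', hgd', -⟩, ⟨hh', hhd', hh0', -⟩⟩ heq
  obtain ⟨h1, h2⟩ := decomposition_unique_of_totalDegree_eq_one (by omega) hg hg' hgd hgd' hh hh'
    hhd hhd' hh0 hh0' heq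
  exact Prod.ext h1 h2

/-- The nonzero forms that are not, up to a constant, proper powers. -/
def nonPowerForms (r e : ℕ) (F : Type*) [Field F] : Set (MvPolynomial (Fin r) F) :=
  {a ∈ nonzeroForms r e F | ¬ IsProperPowerForm e a}

/-- The nonzero forms that are, up to a constant, proper powers. -/
def powerForms (r e : ℕ) (F : Type*) [Field F] : Set (MvPolynomial (Fin r) F) :=
  {a ∈ nonzeroForms r e F | IsProperPowerForm e a}

lemma le_ncard_decomposablePolys_prime [Fintype F] (mo : MonomialOrder (Fin r)) (hr : 1 ≤ r)
    {n d e : ℕ} (hd : d.Prime) (he : 1 ≤ e) (hn : d * e = n) :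
    Fintype.card F ^ (d - 1) * (monicWithTop mo e (nonPowerForms r e F)).ncard ≤
      (decomposablePolys mo n F).ncard := by
  have hn0 : n ≠ 0 := hn ▸ (Nat.mul_pos hd.pos he).ne'
  refine le_trans (le_of_eq ?_) (Set.ncard_le_ncard
    (compositions_subset hd.two_le he hn (nonPowerForms r e F))
    (decomposablePolys_finite mo hr hn0))
  rw [compositions, Set.InjOn.ncard_image, Set.ncard_prod, ncard_monicUnivariate hd.pos]
  rintro ⟨g, h⟩ ⟨⟨hg, hgd, -⟩, ⟨hh, hhd, hh0, hB⟩⟩ ⟨g', h'⟩ ⟨⟨hg', hgd', -⟩, ⟨hh', hhd', hh0', -⟩⟩ heq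
  obtain ⟨h1, h2⟩ := decomposition_unique_of_prime hd he hg hg' hgd hgd' hh hh'
    hhd hhd' hh0 hh0' hB.2 heq
  exact Prod.ext h1 h2

lemma nonzeroForms_C_mul {e : ℕ} {c : F} (hc : c ≠ 0) {f : MvPolynomial (Fin r) F}
    (hf : f ∈ nonzeroForms r e F) : MvPolynomial.C c * f ∈ nonzeroForms r e F :=
  ⟨hf.1.C_mul c, mul_ne_zero (by simpa using hc) hf.2⟩

lemma IsProperPowerForm.C_mul {e : ℕ} {c : F} (hc : c ≠ 0) {f : MvPolynomial (Fin r) F}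
    (hf : IsProperPowerForm e f) : IsProperPowerForm e (MvPolynomial.C c * f) := by
  obtain ⟨k, s, v, c', hs, hk, hv, hc', rfl⟩ := hf
  exact ⟨k, s, v, c * c', hs, hk, hv, mul_ne_zero hc hc', by rw [map_mul, mul_assoc]⟩

lemma nonPowerForms_C_mul {e : ℕ} {c : F} (hc : c ≠ 0) {f : MvPolynomial (Fin r) F}
    (hf : f ∈ nonPowerForms r e F) : MvPolynomial.C c * f ∈ nonPowerForms r e F := by
  refine ⟨nonzeroForms_C_mul hc hf.1, fun h => hf.2 ?_⟩
  have := h.C_mul (inv_ne_zero hc)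
  rwa [← mul_assoc, ← map_mul, inv_mul_cancel₀ hc, map_one, one_mul] at this

lemma ncard_nonPowerForms_add [Fintype F] (hr : 1 ≤ r) (e : ℕ) :
    (nonPowerForms r e F).ncard + (powerForms r e F).ncard = (nonzeroForms r e F).ncard := by
  have hB : (nonzeroForms r e F).Finite := (homForms_finite hr e).subset fun a ha => ha.1
  rw [← Set.ncard_union_eq (Set.disjoint_left.2 fun a h1 h2 => h1.2 h2.2)
    (hB.subset fun a h => h.1) (hB.subset fun a h => h.1)]
  · congr 1
    ext a
    simp only [nonPowerForms, powerForms, Set.mem_union, Set.mem_ofPred_eq]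
    tauto

/-- A monic proper power form is a power of a monic form of at most half the degree. -/
lemma monic_powerForms_subset (mo : MonomialOrder (Fin r)) {e : ℕ} (he : 1 ≤ e) :
    {a ∈ powerForms r e F | mo.Monic a} ⊆ ⋃ k ∈ Finset.Icc 1 (e / 2),
      (fun v => v ^ (e / k)) '' {v ∈ nonzeroForms r k F | mo.Monic v} := by
  rintro a ⟨⟨⟨-, ha0⟩, k, s, v, c, hs, hk, hv, hc, rfl⟩, ham⟩
  have hk0 : 1 ≤ k := by
    rcases Nat.eq_zero_or_pos k with rfl | h
    · omega
    · exact h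
  have hv0 : v ≠ 0 := by
    rintro rfl
    rw [zero_pow (by omega), mul_zero] at ha0
    exact ha0 rfl
  have hl0 : mo.leadingCoeff v ≠ 0 := by rwa [Ne, mo.leadingCoeff_eq_zero_iff]
  simp only [Set.mem_iUnion]
  refine ⟨k, Finset.mem_Icc.2 ⟨hk0, ?_⟩, MvPolynomial.C (mo.leadingCoeff v)⁻¹ * v,
    ⟨nonzeroForms_C_mul (inv_ne_zero hl0) ⟨hv, hv0⟩, ?_⟩, ?_⟩
  · rw [Nat.le_div_iff_mul_le (by omega), ← hk]
    exact Nat.mul_le_mul_left _ hs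
  · rw [MonomialOrder.Monic, mo.leadingCoeff_mul, mo.leadingCoeff_C, inv_mul_cancel₀ hl0]
  -- Monicity reads `c * lc(v) ^ s = 1`, so making `v` monic absorbs `c`.
  · have h1 := ham.leadingCoeff_eq_one
    rw [mo.leadingCoeff_mul, mo.leadingCoeff_C, mo.leadingCoeff_pow] at h1
    simp only
    rw [show e / k = s by rw [← hk, Nat.mul_div_cancel_left _ hk0], mul_pow, ← map_pow, inv_pow,
      eq_inv_of_mul_eq_one_left h1]

/-- Restricting to monic forms and monic bases removes the same factor `q - 1` on both sides.
Summing over all `k ≤ e / 2`, not only divisors of `e`, is a harmless overcount. -/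
lemma ncard_powerForms_le [Fintype F] (mo : MonomialOrder (Fin r)) (hr : 1 ≤ r) {e : ℕ}
    (he : 1 ≤ e) : (powerForms r e F).ncard ≤
      ∑ k ∈ Finset.Icc 1 (e / 2), Fintype.card F ^ (r - 1 + k).choose (r - 1) := by
  have hfin : ∀ k, {v ∈ nonzeroForms r k F | mo.Monic v}.Finite := fun k =>
    (homForms_finite hr k).subset fun a ha => ha.1.1
  rw [ncard_eq_mul_ncard_monic mo (powerForms r e F) (fun h => h.1.2 rfl)
    (fun c hc f hf => ⟨nonzeroForms_C_mul hc hf.1, hf.2.C_mul hc⟩)]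
  refine (Nat.mul_le_mul_left _ ((Set.ncard_le_ncard (monic_powerForms_subset mo he)
    (Set.Finite.biUnion (Finset.finite_toSet _) fun k _ => (hfin k).image _)).trans
    (Finset.set_ncard_biUnion_le _ _))).trans ?_
  rw [Finset.mul_sum]
  refine Finset.sum_le_sum fun k _ => ?_
  refine (Nat.mul_le_mul_left _ (Set.ncard_image_le (hfin k))).trans ?_
  rw [← ncard_eq_mul_ncard_monic mo (nonzeroForms r k F) (fun h => h.2 rfl)
    (fun c hc f hf => nonzeroForms_C_mul hc hf), ncard_nonzeroForms hr]
  exact Nat.sub_le _ _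

end Decomposable

/-! ### Inequalities between binomial exponents, and pair counts -/

section Numeric

/-- The number of monomials of degree `k` in `r` variables. -/
def numMonomials (r k : ℕ) : ℕ := (r - 1 + k).choose (r - 1)

lemma choose_add_eq_choose_add_numMonomials {r e : ℕ} (hr : 1 ≤ r) :
    (r + e).choose r = (r - 1 + e).choose r + numMonomials r e := by
  obtain ⟨r, rfl⟩ : ∃ r', r = r' + 1 := ⟨r - 1, by omega⟩
  rw [numMonomials, Nat.add_sub_cancel, show r + 1 + e = r + e + 1 by ring, Nat.choose_succ_succ]
  ring

lemma numMonomials_succ {r k : ℕ} (hr : 2 ≤ r) :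
    numMonomials r (k + 1) = numMonomials r k + (r - 1 + k).choose (r - 2) := by
  obtain ⟨r, rfl⟩ : ∃ r', r = r' + 2 := ⟨r - 2, by omega⟩
  simp only [numMonomials, Nat.add_sub_cancel, show r + 2 - 1 = r + 1 by omega]
  rw [← add_assoc, Nat.choose_succ_succ, add_comm]

lemma numMonomials_zero (r : ℕ) : numMonomials r 0 = 1 := by simp [numMonomials]

lemma numMonomials_lt_succ {r : ℕ} (hr : 2 ≤ r) (k : ℕ) :
    numMonomials r k < numMonomials r (k + 1) := by
  rw [numMonomials_succ hr]
  have : 0 < (r - 1 + k).choose (r - 2) := Nat.choose_pos (by omega)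
  omega

lemma numMonomials_add_le {r : ℕ} (hr : 2 ≤ r) (k j : ℕ) :
    numMonomials r k + j ≤ numMonomials r (k + j) := by
  induction j with
  | zero => rfl
  | succ j ih =>
    have := numMonomials_lt_succ hr (k + j)
    rw [← add_assoc k j 1]
    omega

lemma numMonomials_mono {r : ℕ} (hr : 2 ≤ r) {k j : ℕ} (h : k ≤ j) :
    numMonomials r k ≤ numMonomials r j := by
  obtain ⟨i, rfl⟩ := Nat.exists_eq_add_of_le h
  have := numMonomials_add_le hr k i
  omega

/-- Convexity: the increments `binom(r-1+a, r-2)` do not decrease with `a`. -/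
lemma numMonomials_add_numMonomials_le {r : ℕ} (hr : 2 ≤ r) (a b : ℕ) :
    numMonomials r a + numMonomials r b ≤ numMonomials r (a + b) + 1 := by
  induction a with
  | zero => rw [numMonomials_zero, zero_add]; omega
  | succ a ih =>
    rw [show a + 1 + b = a + b + 1 by ring, numMonomials_succ hr, numMonomials_succ hr]
    have := Nat.choose_le_choose (r - 2) (show r - 1 + a ≤ r - 1 + (a + b) by omega)
    omega

lemma two_mul_numMonomials_half_le {r : ℕ} (hr : 2 ≤ r) (e : ℕ) :
    2 * numMonomials r (e / 2) ≤ numMonomials r e + 1 := by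
  have h1 := numMonomials_add_numMonomials_le hr (e / 2) (e / 2)
  have h2 := numMonomials_mono hr (show e / 2 + e / 2 ≤ e by omega)
  omega

lemma choose_add_le_choose_add {r : ℕ} (hr : 2 ≤ r) {k : ℕ} (hk : 1 ≤ k) (j : ℕ) :
    (r + k).choose r + 2 * j ≤ (r + (k + j)).choose r := by
  induction j with
  | zero => rfl
  | succ j ih =>
    rw [choose_add_eq_choose_add_numMonomials (e := k + (j + 1)) (by omega),
      show r - 1 + (k + (j + 1)) = r + (k + j) by omega]
    have h1 := numMonomials_add_le hr 0 (k + (j + 1))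
    rw [numMonomials_zero, zero_add] at h1
    omega

/-- Compares a divisor `d` other than `l` and `n` with `d = l`. The surplus `2 * (e - 1 - k)` later
makes the sum over such `d` geometric. -/
lemma exponent_middle_le {r l e d k : ℕ} (hr : 2 ≤ r) (hl : 1 ≤ l) (hlk : l ≤ k) (hke : k < e)
    (hdk : d * k = l * e) :
    2 * ((r + k).choose r + d) + numMonomials r e + 2 * (e - 1 - k) ≤
      2 * ((r + e).choose r + l) + 2 := by
  have h1 := choose_add_le_choose_add hr (show 1 ≤ k by omega) (e - 1 - k)
  rw [show k + (e - 1 - k) = e - 1 by omega] at h1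
  have h2 := choose_add_eq_choose_add_numMonomials (r := r) (e := e) (by omega)
  rw [show r - 1 + e = r + (e - 1) by omega] at h2
  -- Equivalent to `(k - l) * (e - k) ≥ 0` after multiplying by `k`.
  have h3 : d ≤ l + (e - k) := by
    have hk : 0 < k := by omega
    refine Nat.le_of_mul_le_mul_right ?_ hk
    obtain ⟨j, rfl⟩ := Nat.exists_eq_add_of_lt hke
    rw [hdk, show k + j + 1 - k = j + 1 by omega]
    nlinarith
  omega

lemma numMonomials_three_le {r e : ℕ} (hr : 3 ≤ r) (he : 2 ≤ e) :
    2 * e * (e - 1) + 2 * r ≤ 2 * (r - 1 + e).choose r + numMonomials r e := by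
  induction r, hr using Nat.le_induction with
  | base =>
    have h1 : 6 * (e + 2).choose 3 = (e + 2) * (e + 1) * e := by
      have := Nat.descFactorial_eq_factorial_mul_choose (e + 2) 3
      simp [Nat.descFactorial, Nat.factorial] at this
      rw [← this]; ring
    have h2 : 2 * (e + 2).choose 2 = (e + 2) * (e + 1) := by
      have := Nat.descFactorial_eq_factorial_mul_choose (e + 2) 2
      simp [Nat.descFactorial, Nat.factorial] at this
      rw [← this]; ring
    simp only [numMonomials, show 3 - 1 + e = e + 2 by omega, show 3 - 1 = 2 by rfl]
    obtain ⟨x, rfl⟩ : ∃ x, e = x + 2 := ⟨e - 2, by omega⟩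
    rw [show x + 2 - 1 = x + 1 by omega]
    nlinarith
  | succ r hr ih =>
    have h1 := choose_add_eq_choose_add_numMonomials (r := r) (e := e) (by omega)
    have h2 : (r + e).choose (r + 1) = (r - 1 + e).choose r + (r - 1 + e).choose (r + 1) := by
      rw [show r + e = (r - 1 + e) + 1 by omega, Nat.choose_succ_succ]
    have h3 : 0 < (r - 1 + e).choose (r + 1) := Nat.choose_pos (by omega)
    simp only [numMonomials, Nat.add_sub_cancel] at *
    omega

lemma choose_two_formula (e : ℕ) : 2 * (2 + e).choose 2 = (e + 2) * (e + 1) := by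
  have := Nat.descFactorial_eq_factorial_mul_choose (e + 2) 2
  simp [Nat.descFactorial, Nat.factorial] at this
  rw [add_comm 2 e, ← this]; ring

lemma numMonomials_two (e : ℕ) : numMonomials 2 e = e + 1 := by
  simp [numMonomials]; ring

/-- Compares `d = n` with `d = l`. For `r = 2` the difference of the sides is exactly `(e - 1) * (e
+ 3 - 2 * l)`, hence the hypothesis; for `r ≥ 3` the binomial growth suffices even at `l = e`. -/
lemma exponent_last_le {r l e : ℕ} (hr : 2 ≤ r) (hle : l ≤ e) (hl : 2 ≤ l)
    (h : r = 2 → 2 * l ≤ e + 3) :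
    numMonomials r e + 2 * (l * e) + 2 * r ≤ 2 * (r + e).choose r + 2 * l := by
  rcases hr.eq_or_lt with rfl | hr3
  · rw [choose_two_formula, numMonomials_two]
    have := h rfl
    zify at *
    nlinarith [mul_nonneg (show (0 : ℤ) ≤ e - 1 by omega) (show (0 : ℤ) ≤ e + 3 - 2 * l by omega)]
  · have h1 := numMonomials_three_le hr3 (show 2 ≤ e by omega)
    rw [choose_add_eq_choose_add_numMonomials (by omega)]
    obtain ⟨x, rfl⟩ : ∃ x, e = x + 1 := ⟨e - 1, by omega⟩
    rw [Nat.add_sub_cancel] at h1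
    nlinarith [Nat.mul_le_mul_right x hle]

/-- The number of pairs `(g, h)` with `deg g = d` and `deg h = e`, in the shape of `decompAlpha`. -/
noncomputable def pairCount (q r d e : ℕ) : ℝ :=
  (q : ℝ) ^ (((r + e).choose r : ℤ) + (d : ℤ) - 3) *
    ((1 - (q : ℝ) ^ (-(numMonomials r e : ℤ))) / (1 - (q : ℝ)⁻¹))

lemma decompAlpha_eq_pairCount (q r n : ℕ) :
    decompAlpha q r n = pairCount q r (decompM r n) (n / decompM r n) := rfl

lemma pairCount_eq {q r d e : ℕ} (hq : 2 ≤ q) (hr : 1 ≤ r) (hd : 1 ≤ d) (he : 1 ≤ e) {M : ℝ}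
    (hM : ((q : ℝ) - 1) * M =
      ((q : ℝ) ^ numMonomials r e - 1) * (q : ℝ) ^ ((r - 1 + e).choose r - 1)) :
    pairCount q r d e = (q : ℝ) ^ (d - 1) * M := by
  have hq' : (2 : ℝ) ≤ q := by exact_mod_cast hq
  have hq0 : (q : ℝ) ≠ 0 := by positivity
  have hq1 : (q : ℝ) - 1 ≠ 0 := by linarith
  have hC : 0 < (r - 1 + e).choose r := Nat.choose_pos (by omega)
  rw [pairCount, choose_add_eq_choose_add_numMonomials hr]
  have hM' : M = ((q : ℝ) ^ numMonomials r e - 1) * (q : ℝ) ^ ((r - 1 + e).choose r - 1) / (q - 1) := by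
    rw [← hM]; field_simp
  rw [hM', show ((((r - 1 + e).choose r + numMonomials r e : ℕ) : ℤ) + (d : ℤ) - 3) =
    ((d - 1 : ℕ) : ℤ) + ((((r - 1 + e).choose r - 1 : ℕ) : ℤ) + ((numMonomials r e : ℕ) : ℤ) - 1) by omega,
    zpow_add₀ hq0, zpow_sub₀ hq0, zpow_add₀ hq0, zpow_neg, zpow_natCast, zpow_natCast, zpow_natCast,
    zpow_one]
  field_simp

variable {q : ℕ}

lemma one_sub_inv_pos (hq : 2 ≤ q) : 0 < 1 - (q : ℝ)⁻¹ := by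
  have hq' : (2 : ℝ) ≤ q := by exact_mod_cast hq
  rw [sub_pos]
  exact inv_lt_one_of_one_lt₀ (by linarith)

/-- Reduces comparison with the half-integral power in `β` to an integer inequality, doubled. -/
lemma zpow_le_rpow (hq : 2 ≤ q) {w : ℤ} {N : ℕ} (h : 2 * w ≤ 2 - N) :
    (q : ℝ) ^ w ≤ (q : ℝ) ^ (-(1 / 2 : ℝ) * (N : ℝ) + 1) := by
  have hq' : (2 : ℝ) ≤ q := by exact_mod_cast hq
  rw [← Real.rpow_intCast]
  refine Real.rpow_le_rpow_of_exponent_le (by linarith) ?_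
  have : ((2 * w : ℤ) : ℝ) ≤ ((2 - N : ℤ) : ℝ) := by exact_mod_cast h
  push_cast at this
  linarith

lemma sum_pow_inv_le (hq : 2 ≤ q) (s : Finset ℕ) (f : ℕ → ℕ) (hf : Set.InjOn f s) :
    ∑ k ∈ s, ((q : ℝ)⁻¹) ^ f k ≤ 1 / (1 - (q : ℝ)⁻¹) := by
  have hq' : (2 : ℝ) ≤ q := by exact_mod_cast hq
  have h1 : (q : ℝ)⁻¹ < 1 := inv_lt_one_of_one_lt₀ (by linarith)
  have h0 : 0 ≤ (q : ℝ)⁻¹ := by positivity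
  rw [← Finset.sum_image (f := fun j => ((q : ℝ)⁻¹) ^ j) hf, one_div,
    ← tsum_geometric_of_lt_one h0 h1]
  exact (summable_geometric_of_lt_one h0 h1).sum_le_tsum _ fun i _ => pow_nonneg h0 i

lemma pairCount_nonneg (hq : 2 ≤ q) (r d e : ℕ) : 0 ≤ pairCount q r d e := by
  have hq' : (2 : ℝ) ≤ q := by exact_mod_cast hq
  refine mul_nonneg (by positivity) (div_nonneg ?_ (one_sub_inv_pos hq).le)
  rw [sub_nonneg, zpow_neg, zpow_natCast]
  exact inv_le_one_of_one_le₀ (one_le_pow₀ (by linarith))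

/-- The factor `1 - q^(-numMonomials r e)` grows with `e`, so for `e' ≤ e` only the exponents
matter. -/
lemma pairCount_le_mul {r d e d' e' : ℕ} (hq : 2 ≤ q) (hr : 2 ≤ r) (hee : e' ≤ e) :
    pairCount q r d' e' ≤ pairCount q r d e *
      (q : ℝ) ^ (((r + e').choose r + d' : ℤ) - ((r + e).choose r + d : ℤ)) := by
  have hq' : (2 : ℝ) ≤ q := by exact_mod_cast hq
  have hq0 : (q : ℝ) ≠ 0 := by positivity
  have hN := numMonomials_mono hr hee
  have h1 : pairCount q r d e *
      (q : ℝ) ^ (((r + e').choose r + d' : ℤ) - ((r + e).choose r + d : ℤ)) =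
      (q : ℝ) ^ (((r + e').choose r : ℤ) + (d' : ℤ) - 3) *
      ((1 - (q : ℝ) ^ (-(numMonomials r e : ℤ))) / (1 - (q : ℝ)⁻¹)) := by
    rw [pairCount, mul_right_comm, ← zpow_add₀ hq0]
    congr 2; ring
  rw [h1, pairCount]
  refine mul_le_mul_of_nonneg_left ?_ (by positivity)
  refine div_le_div_of_nonneg_right ?_ (one_sub_inv_pos hq).le
  refine sub_le_sub_left (zpow_le_zpow_right₀ (by linarith) ?_) _
  omega

end Numeric

/-! ### Error terms relative to the main term -/

section Bounds

variable {q : ℕ}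

lemma decompBeta_eq (q r n : ℕ) : decompBeta q r n =
    2 * (q : ℝ) ^ (-(1 / 2 : ℝ) * (numMonomials r (n / n.minFac) : ℝ) + 1) / (1 - (q : ℝ)⁻¹) := rfl

/-- If `m` is the smallest prime divisor, the other divisors contribute little. -/
lemma sum_pairCount_erase_minFac_le {r n : ℕ} (hq : 2 ≤ q) (hr : 2 ≤ r) (hn : 2 ≤ n)
    (hcomp : ¬ n.Prime) (hm : r = 2 → 2 * n.minFac ≤ n / n.minFac + 3) :
    ∑ d ∈ (n.divisors.filter (2 ≤ ·)).erase n.minFac, pairCount q r d (n / d) ≤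
      pairCount q r n.minFac (n / n.minFac) * decompBeta q r n := by
  have hq' : (2 : ℝ) ≤ q := by exact_mod_cast hq
  have hq0 : (q : ℝ) ≠ 0 := by positivity
  rw [decompBeta_eq]
  have hlp := Nat.minFac_prime (show n ≠ 1 by omega)
  have hle : n.minFac * (n / n.minFac) = n := Nat.mul_div_cancel' n.minFac_dvd
  have hmin : n.minFac ≤ n / n.minFac := Nat.minFac_le_div (by omega) hcomp
  have hmf : ∀ k, 2 ≤ k → k ∣ n → n.minFac ≤ k := fun k h1 h2 => Nat.minFac_le_of_dvd h1 h2
  set l := n.minFac with hl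
  set e := n / l with he
  set P := pairCount q r l e with hP
  have hP0 : 0 ≤ P := pairCount_nonneg hq r l e
  set y := (q : ℝ) ^ (-(1 / 2 : ℝ) * (numMonomials r e : ℝ) + 1) with hy
  have hy0 : 0 ≤ y := by positivity
  set S := (n.divisors.filter (2 ≤ ·)).erase l with hS
  have hmem : ∀ d ∈ S, d ≠ l ∧ 2 ≤ d ∧ d ∣ n := fun d hd => by
    have h1 := Finset.mem_erase.1 hd
    have h2 := Finset.mem_filter.1 h1.2
    exact ⟨h1.1, h2.2, Nat.dvd_of_mem_divisors h2.1⟩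
  have hlast : pairCount q r n (n / n) ≤ P * y := by
    rw [Nat.div_self (by omega)]
    refine (pairCount_le_mul (d := l) (e := e) hq hr (by have := hlp.two_le; omega)).trans
      (mul_le_mul_of_nonneg_left (zpow_le_rpow hq ?_) hP0)
    have h1 := exponent_last_le hr hmin hlp.two_le hm
    rw [hle] at h1
    rw [Nat.choose_succ_self_right]
    push_cast
    omega
  have hmid : ∀ d ∈ S.erase n, pairCount q r d (n / d) ≤
      P * y * ((q : ℝ)⁻¹) ^ (e - 1 - n / d) := by
    intro d hd
    obtain ⟨hdn, hdS⟩ := Finset.mem_erase.1 hd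
    obtain ⟨hdl, hd2, hdd⟩ := hmem d hdS
    have hld := hmf d hd2 hdd
    have hdk : d * (n / d) = n := Nat.mul_div_cancel' hdd
    have hk2 : 2 ≤ n / d := by
      have h0 : n / d ≠ 0 := by intro h; rw [h] at hdk; omega
      have h1 : n / d ≠ 1 := by
        intro h
        rw [h, mul_one] at hdk
        exact (Finset.mem_erase.1 hd).1 hdk
      exact (Nat.two_le_iff _).2 ⟨h0, h1⟩
    have hlk := hmf _ hk2 (Nat.div_dvd_of_dvd hdd)
    have hke : n / d < e := by
      by_contra h
      have h1 : l * e ≤ l * (n / d) := Nat.mul_le_mul_left _ (not_lt.1 h)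
      have h2 : l * (n / d) < d * (n / d) := Nat.mul_lt_mul_of_pos_right (by omega) (by omega)
      omega
    have h1 := exponent_middle_le hr hlp.one_lt.le hlk hke (hdk.trans hle.symm)
    refine (pairCount_le_mul (d := l) (e := e) hq hr hke.le).trans ?_
    rw [mul_assoc]
    refine mul_le_mul_of_nonneg_left ?_ hP0
    rw [inv_pow, ← zpow_natCast, ← div_eq_mul_inv, le_div_iff₀ (by positivity), ← zpow_add₀ hq0]
    refine zpow_le_rpow hq ?_
    omega
  have hsum : ∑ d ∈ S.erase n, pairCount q r d (n / d) ≤ P * y * (1 / (1 - (q : ℝ)⁻¹)) := by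
    refine (Finset.sum_le_sum hmid).trans ?_
    rw [← Finset.mul_sum]
    refine mul_le_mul_of_nonneg_left (sum_pow_inv_le hq _ _ ?_) (mul_nonneg hP0 hy0)
    -- Without `n / d < e` the truncated exponents `e - 1 - n / d` could collide.
    have hlt : ∀ d ∈ S.erase n, n / d < e ∧ d * (n / d) = n := fun d hd => by
      obtain ⟨hdn, hdS⟩ := Finset.mem_erase.1 hd
      obtain ⟨hdl, hd2, hdd⟩ := hmem d hdS
      have hld := hmf d hd2 hdd
      have hdk : d * (n / d) = n := Nat.mul_div_cancel' hdd
      refine ⟨?_, hdk⟩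
      by_contra h
      have h1 : l * e ≤ l * (n / d) := Nat.mul_le_mul_left _ (not_lt.1 h)
      have h0 : 0 < n / d := by
        rw [Nat.pos_iff_ne_zero]; intro h; rw [h] at hdk; omega
      have h2 : l * (n / d) < d * (n / d) := Nat.mul_lt_mul_of_pos_right (by omega) h0
      omega
    intro d hd d' hd' heq
    obtain ⟨h1, h2⟩ := hlt d hd
    obtain ⟨h1', h2'⟩ := hlt d' hd'
    simp only at heq
    have h3 : n / d = n / d' := by omega
    refine Nat.eq_of_mul_eq_mul_right (m := n / d) ?_ ?_
    · rw [Nat.pos_iff_ne_zero]; intro h; rw [h] at h2; omega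
    · rw [h2, h3, h2']
  have hnS : n ∈ S := by
    refine Finset.mem_erase.2 ⟨?_, Finset.mem_filter.2 ⟨Nat.mem_divisors_self n (by omega), hn⟩⟩
    intro h
    exact hcomp (h ▸ hlp)
  rw [← Finset.add_sum_erase _ _ hnS]
  have hinv := one_sub_inv_pos hq
  -- The divisor `n` and the middle divisors each cost at most half of `P * β`; this is the `2` in
  -- `β`.
  have h1 : 1 ≤ 1 / (1 - (q : ℝ)⁻¹) := by
    rw [le_div_iff₀ hinv]
    have : 0 ≤ (q : ℝ)⁻¹ := by positivity
    linarith
  have h2 : P * y ≤ P * y * (1 / (1 - (q : ℝ)⁻¹)) :=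
    le_mul_of_one_le_right (mul_nonneg hP0 hy0) h1
  have h3 : P * (2 * y / (1 - (q : ℝ)⁻¹)) = 2 * (P * y * (1 / (1 - (q : ℝ)⁻¹))) := by ring
  linarith

lemma eq_or_eq_of_dvd_mul_prime {l e d : ℕ} (hl : l.Prime) (he : e.Prime) (hd : d ∣ l * e)
    (hd2 : 2 ≤ d) (hdn : d ≠ l * e) : d = l ∨ d = e := by
  rcases (Nat.dvd_mul.1 hd) with ⟨a, b, ha, hb, rfl⟩
  rcases (Nat.dvd_prime hl).1 ha with rfl | rfl <;> rcases (Nat.dvd_prime he).1 hb with rfl | rfl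
  · omega
  · right; ring
  · left; ring
  · exact absurd rfl hdn

/-- If `m = n`, the other divisors contribute little. -/
lemma sum_pairCount_erase_self_le {n : ℕ} (hq : 2 ≤ q) (hn : 2 ≤ n)
    (he : (n / n.minFac).Prime) (hcomp : ¬ n.Prime) (hm : n / n.minFac + 5 ≤ 2 * n.minFac) :
    ∑ d ∈ (n.divisors.filter (2 ≤ ·)).erase n, pairCount q 2 d (n / d) ≤
      pairCount q 2 n 1 * decompBeta q 2 n := by
  have hq' : (2 : ℝ) ≤ q := by exact_mod_cast hq
  have hq0 : (q : ℝ) ≠ 0 := by positivity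
  have hinv := one_sub_inv_pos hq
  rw [decompBeta_eq]
  have hlp := Nat.minFac_prime (show n ≠ 1 by omega)
  have hle : n.minFac * (n / n.minFac) = n := Nat.mul_div_cancel' n.minFac_dvd
  have hmin : n.minFac ≤ n / n.minFac := Nat.minFac_le_div (by omega) hcomp
  set l := n.minFac with hl
  set e := n / l with he'
  set y := (q : ℝ) ^ (-(1 / 2 : ℝ) * (numMonomials 2 e : ℝ) + 1) with hy
  have hy0 : 0 ≤ y := by positivity
  -- `binom(3, 2)` cancels the `-3`, and the remaining quotient is `(1 - q⁻²) / (1 - q⁻¹) ≥ 1`.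
  have hqn : (q : ℝ) ^ (n : ℤ) ≤ pairCount q 2 n 1 := by
    rw [pairCount, numMonomials_two]
    have h1 : ((2 + 1).choose 2 : ℤ) + n - 3 = n := by norm_num [Nat.choose]
    rw [h1]
    refine le_mul_of_one_le_right (by positivity) ?_
    rw [one_le_div hinv]
    refine sub_le_sub_left ?_ _
    rw [← zpow_neg_one]
    exact zpow_le_zpow_right₀ (by linarith) (by norm_num)
  -- The condition says that the exponent minus `n` is at most `-(e + 1)/2 + 1`, the exponent of
  -- `y`.
  have hterm : ∀ d k, 2 * ((2 + k).choose 2 + d) + e ≤ 2 * n + 7 →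
      pairCount q 2 d k ≤ pairCount q 2 n 1 * y / (1 - (q : ℝ)⁻¹) := by
    intro d k hdk
    have h1 : (q : ℝ) ^ (((2 + k).choose 2 : ℤ) + (d : ℤ) - 3) ≤ q ^ (n : ℤ) * y := by
      have h2 : (q : ℝ) ^ (((2 + k).choose 2 : ℤ) + (d : ℤ) - 3 - n) ≤ y := by
        refine zpow_le_rpow hq ?_
        rw [numMonomials_two]
        push_cast
        omega
      have h3 : ((2 + k).choose 2 : ℤ) + (d : ℤ) - 3 =
        n + (((2 + k).choose 2 : ℤ) + (d : ℤ) - 3 - n) := by ring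
      rw [h3, zpow_add₀ hq0]
      exact mul_le_mul_of_nonneg_left h2 (by positivity)
    rw [pairCount, mul_div_assoc']
    refine div_le_div_of_nonneg_right ?_ hinv.le
    have h4 : 1 - (q : ℝ) ^ (-(numMonomials 2 k : ℤ)) ≤ 1 := by
      have : 0 ≤ (q : ℝ) ^ (-(numMonomials 2 k : ℤ)) := by positivity
      linarith
    refine (mul_le_of_le_one_right (by positivity) h4).trans (h1.trans ?_)
    exact mul_le_mul_of_nonneg_right hqn hy0
  have hB0 : 0 ≤ pairCount q 2 n 1 * y / (1 - (q : ℝ)⁻¹) :=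
    div_nonneg (mul_nonneg (pairCount_nonneg hq _ _ _) hy0) hinv.le
  have hmem : ∀ d ∈ (n.divisors.filter (2 ≤ ·)).erase n, d = l ∨ d = e := by
    intro d hd
    obtain ⟨hdn, hd'⟩ := Finset.mem_erase.1 hd
    obtain ⟨hd1, hd2⟩ := Finset.mem_filter.1 hd'
    exact eq_or_eq_of_dvd_mul_prime hlp he (hle.symm ▸ Nat.dvd_of_mem_divisors hd1) hd2
      (hle.symm ▸ hdn)
  have hall : ∀ d ∈ (n.divisors.filter (2 ≤ ·)).erase n, pairCount q 2 d (n / d) ≤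
      pairCount q 2 n 1 * y / (1 - (q : ℝ)⁻¹) := by
    intro d hd
    refine hterm _ _ ?_
    have hc1 := choose_two_formula l
    have hc2 := choose_two_formula e
    rcases hmem d hd with rfl | rfl
    -- For `d = l` the slack is exactly `(e - 1) * (2 * l - 5 - e)`, the source of the threshold `2ℓ
    -- - 5`.
    · rw [← he', mul_add, hc2]
      nlinarith [mul_nonneg (show (0 : ℤ) ≤ e - 1 by omega) (show (0 : ℤ) ≤ 2 * l - 5 - e by omega)]
    -- For `d = e`, the bounds `l ≤ e ≤ 2 * l - 5` give `l ≥ 5`.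
    · have hdiv : n / e = l := by
        rw [← hle]; exact Nat.mul_div_cancel _ he.pos
      rw [hdiv, mul_add, hc1]
      zify at *
      nlinarith [mul_nonneg (show (0 : ℤ) ≤ l - 5 by omega) (show (0 : ℤ) ≤ e - l by omega)]
  have hcard : ((n.divisors.filter (2 ≤ ·)).erase n).card ≤ 2 := by
    refine (Finset.card_le_card (t := {l, e}) fun d hd => ?_).trans Finset.card_le_two
    simpa using hmem d hd
  refine (Finset.sum_le_card_nsmul _ _ _ hall).trans ?_
  rw [nsmul_eq_mul]
  refine (mul_le_mul_of_nonneg_right (show (_ : ℝ) ≤ 2 by exact_mod_cast hcard) hB0).trans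
    (le_of_eq ?_)
  ring

/-- Proper powers are few among the forms of degree `e`. -/
lemma sum_pow_numMonomials_le {r e : ℕ} (hq : 2 ≤ q) (hr : 2 ≤ r) (he : 1 ≤ e) :
    ∑ k ∈ Finset.Icc 1 (e / 2), (q : ℝ) ^ numMonomials r k ≤ ((q : ℝ) ^ numMonomials r e - 1) *
      (2 * (q : ℝ) ^ (-(1 / 2 : ℝ) * (numMonomials r e : ℝ) + 1) / (1 - (q : ℝ)⁻¹)) := by
  have hq' : (2 : ℝ) ≤ q := by exact_mod_cast hq
  have hq0 : (q : ℝ) ≠ 0 := by positivity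
  have hinv := one_sub_inv_pos hq
  set y := (q : ℝ) ^ (-(1 / 2 : ℝ) * (numMonomials r e : ℝ) + 1) with hy
  have hy0 : 0 ≤ y := by positivity
  have h1 : ∑ k ∈ Finset.Icc 1 (e / 2), (q : ℝ) ^ numMonomials r k ≤
      (q : ℝ) ^ numMonomials r (e / 2) * (1 / (1 - (q : ℝ)⁻¹)) := by
    have hterm : ∀ k ∈ Finset.Icc 1 (e / 2), (q : ℝ) ^ numMonomials r k ≤
        (q : ℝ) ^ numMonomials r (e / 2) * ((q : ℝ)⁻¹) ^ (e / 2 - k) := by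
      intro k hk
      obtain ⟨hk1, hk2⟩ := Finset.mem_Icc.1 hk
      have h := numMonomials_add_le hr k (e / 2 - k)
      rw [show k + (e / 2 - k) = e / 2 by omega] at h
      rw [inv_pow, ← div_eq_mul_inv, le_div_iff₀ (by positivity), ← pow_add]
      exact pow_le_pow_right₀ (by linarith) h
    refine (Finset.sum_le_sum hterm).trans ?_
    rw [← Finset.mul_sum]
    refine mul_le_mul_of_nonneg_left (sum_pow_inv_le hq _ _ ?_) (by positivity)
    intro k hk k' hk' h
    have := (Finset.mem_Icc.1 hk).2
    have := (Finset.mem_Icc.1 hk').2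
    omega
  have h2 : (q : ℝ) ^ numMonomials r (e / 2) ≤ (q : ℝ) ^ numMonomials r e * y := by
    have h3 : (q : ℝ) ^ ((numMonomials r (e / 2) : ℤ) - numMonomials r e) ≤ y := by
      refine zpow_le_rpow hq ?_
      have := two_mul_numMonomials_half_le hr e
      omega
    rw [zpow_sub₀ hq0, zpow_natCast, zpow_natCast, div_le_iff₀ (by positivity)] at h3
    linarith
  -- Passing from all forms to nonzero forms costs the factor `2` available in `β`.
  have h4 : (q : ℝ) ^ numMonomials r e ≤ 2 * ((q : ℝ) ^ numMonomials r e - 1) := by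
    have h5 := numMonomials_add_le hr 0 e
    rw [zero_add, numMonomials_zero] at h5
    have h6 : (q : ℝ) ^ 1 ≤ (q : ℝ) ^ numMonomials r e :=
      pow_le_pow_right₀ (by linarith) (by omega)
    rw [pow_one] at h6
    linarith
  refine h1.trans ?_
  rw [mul_one_div, mul_div_assoc']
  refine div_le_div_of_nonneg_right (h2.trans ?_) hinv.le
  have h7 := mul_le_mul_of_nonneg_right h4 hy0
  linarith

end Bounds

/-! ### From cardinalities to real estimates, and the main theorem -/

section Main

variable {F : Type*} [Field F] [Fintype F]

lemma sub_one_mul_ncard_monicWithTop {r : ℕ} (mo : MonomialOrder (Fin r)) (hr : 1 ≤ r) {e : ℕ}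
    (he : 1 ≤ e) {B : Set (MvPolynomial (Fin r) F)} (hB : B ⊆ nonzeroForms r e F)
    (hBC : ∀ c : F, c ≠ 0 → ∀ f ∈ B, MvPolynomial.C c * f ∈ B) :
    ((Fintype.card F : ℝ) - 1) * ((monicWithTop mo e B).ncard : ℝ) =
      (B.ncard : ℝ) * (Fintype.card F : ℝ) ^ ((r - 1 + e).choose r - 1) := by
  have h := ncard_monicWithTop mo hr he hB hBC
  have h1 : ((Fintype.card F - 1 : ℕ) : ℝ) = (Fintype.card F : ℝ) - 1 := by
    rw [Nat.cast_sub Fintype.card_pos, Nat.cast_one]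
  rw [← h1]
  exact_mod_cast h

lemma cast_ncard_nonzeroForms {r : ℕ} (hr : 1 ≤ r) (e : ℕ) :
    ((nonzeroForms r e F).ncard : ℝ) = (Fintype.card F : ℝ) ^ numMonomials r e - 1 := by
  rw [ncard_nonzeroForms hr, Nat.cast_sub (Nat.one_le_pow _ _ Fintype.card_pos), Nat.cast_pow,
    Nat.cast_one, numMonomials]

lemma pairCount_eq_ncard {r : ℕ} (mo : MonomialOrder (Fin r)) (hr : 1 ≤ r) {d e : ℕ}
    (hd : 1 ≤ d) (he : 1 ≤ e) : pairCount (Fintype.card F) r d e =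
      (Fintype.card F : ℝ) ^ (d - 1) * ((monicWithTop mo e (nonzeroForms r e F)).ncard : ℝ) := by
  refine pairCount_eq Fintype.one_lt_card hr hd he ?_
  rw [sub_one_mul_ncard_monicWithTop mo hr he subset_rfl
    (fun c hc f hf => nonzeroForms_C_mul hc hf), cast_ncard_nonzeroForms hr]

lemma ncard_decomposablePolys_le_sum_pairCount {r : ℕ} (mo : MonomialOrder (Fin r)) (hr : 1 ≤ r)
    {n : ℕ} (hn : n ≠ 0) : ((decomposablePolys mo n F).ncard : ℝ) ≤
      ∑ d ∈ n.divisors.filter (2 ≤ ·), pairCount (Fintype.card F) r d (n / d) := by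
  have h := ncard_decomposablePolys_le (F := F) mo hr hn
  refine (Nat.cast_le (α := ℝ).2 h).trans (le_of_eq ?_)
  rw [Nat.cast_sum]
  refine Finset.sum_congr rfl fun d hd => ?_
  obtain ⟨hd1, hd2⟩ := Finset.mem_filter.1 hd
  rw [pairCount_eq_ncard mo hr (by omega) (div_pos_of_mem_divisors hd1)]
  push_cast
  rfl

/-- Pairs whose inner top form is not a proper power compose injectively, and the discarded pairs
have the same proportion as the power forms among the nonzero forms. -/
lemma pairCount_sub_le_ncard {r : ℕ} (mo : MonomialOrder (Fin r)) (hr : 2 ≤ r) {n d e : ℕ}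
    (hd : d.Prime) (he : 1 ≤ e) (hn : d * e = n) :
    pairCount (Fintype.card F) r d e - pairCount (Fintype.card F) r d e *
      (2 * (Fintype.card F : ℝ) ^ (-(1 / 2 : ℝ) * (numMonomials r e : ℝ) + 1) /
        (1 - (Fintype.card F : ℝ)⁻¹)) ≤ ((decomposablePolys mo n F).ncard : ℝ) := by
  have hr1 : 1 ≤ r := by omega
  have hq : 2 ≤ Fintype.card F := Fintype.one_lt_card
  have hq' : (2 : ℝ) ≤ Fintype.card F := by exact_mod_cast hq
  have hle := Nat.cast_le (α := ℝ).2 (le_ncard_decomposablePolys_prime (F := F) mo hr1 hd he hn)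
  push_cast at hle
  have hall := sub_one_mul_ncard_monicWithTop mo hr1 he (subset_refl (nonzeroForms r e F))
    (fun c hc f hf => nonzeroForms_C_mul hc hf)
  have hgood := sub_one_mul_ncard_monicWithTop mo hr1 he
    (B := nonPowerForms r e F) (fun a ha => ha.1) (fun c hc f hf => nonPowerForms_C_mul hc hf)
  have hadd : ((nonPowerForms r e F).ncard : ℝ) + ((powerForms r e F).ncard : ℝ) =
      ((nonzeroForms r e F).ncard : ℝ) := by exact_mod_cast ncard_nonPowerForms_add hr1 e
  have hbad : ((powerForms r e F).ncard : ℝ) ≤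
      ∑ k ∈ Finset.Icc 1 (e / 2), (Fintype.card F : ℝ) ^ numMonomials r k := by
    exact_mod_cast ncard_powerForms_le (F := F) mo hr1 he
  have hbad' := hbad.trans (sum_pow_numMonomials_le hq hr he)
  rw [← cast_ncard_nonzeroForms (F := F) hr1] at hbad'
  rw [pairCount_eq_ncard mo hr1 hd.pos he]
  refine le_trans ?_ hle
  set β := 2 * (Fintype.card F : ℝ) ^ (-(1 / 2 : ℝ) * (numMonomials r e : ℝ) + 1) /
        (1 - (Fintype.card F : ℝ)⁻¹) with hβ
  set Q := (Fintype.card F : ℝ)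
  set L := Q ^ ((r - 1 + e).choose r - 1) with hL
  have hL0 : 0 ≤ L := by positivity
  rw [mul_assoc, ← mul_sub]
  refine mul_le_mul_of_nonneg_left ?_ (by positivity)
  refine le_of_mul_le_mul_left ?_ (show 0 < Q - 1 by linarith)
  rw [mul_sub, ← mul_assoc, hall, hgood]
  have h1 := mul_le_mul_of_nonneg_right hbad' hL0
  rw [← hadd] at h1 ⊢
  linarith

end Main

theorem theorem2p24 (F : Type*) [Field F] [Fintype F] (r n : ℕ) (hr : 2 ≤ r) (hn : 2 ≤ n)
    (hcomp : ¬ n.Prime) (mo : MonomialOrder (Fin r)) :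
    (decomposablePolys mo n F).Finite ∧
      |((decomposablePolys mo n F).ncard : ℝ) - decompAlpha (Fintype.card F) r n| ≤
        decompAlpha (Fintype.card F) r n * decompBeta (Fintype.card F) r n := by
  have hr1 : 1 ≤ r := by omega
  have hq : 2 ≤ Fintype.card F := Fintype.one_lt_card
  refine ⟨decomposablePolys_finite mo hr1 (by omega), ?_⟩
  have hlp := Nat.minFac_prime (show n ≠ 1 by omega)
  have hle : n.minFac * (n / n.minFac) = n := Nat.mul_div_cancel' n.minFac_dvd
  have hmin : n.minFac ≤ n / n.minFac := Nat.minFac_le_div (by omega) hcomp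
  have hupper := ncard_decomposablePolys_le_sum_pairCount (F := F) mo hr1 (show n ≠ 0 by omega)
  rw [decompAlpha_eq_pairCount]
  by_cases hm : r = 2 ∧ (n / n.minFac).Prime ∧ ((n / n.minFac : ℕ) : ℤ) ≤ 2 * (n.minFac : ℤ) - 5
  · rw [decompM, if_pos hm, Nat.div_self (by omega)]
    obtain ⟨rfl, he, hle5⟩ := hm
    have hβ : 0 ≤ pairCount (Fintype.card F) 2 n 1 * decompBeta (Fintype.card F) 2 n := by
      rw [decompBeta_eq]
      exact mul_nonneg (pairCount_nonneg hq _ _ _)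
        (div_nonneg (by positivity) (one_sub_inv_pos hq).le)
    have hsum := sum_pairCount_erase_self_le hq hn he hcomp (by omega)
    have hself : n ∈ n.divisors.filter (2 ≤ ·) :=
      Finset.mem_filter.2 ⟨Nat.mem_divisors_self n (by omega), hn⟩
    rw [← Finset.add_sum_erase _ _ hself, Nat.div_self (by omega)] at hupper
    have hlower := Nat.cast_le (α := ℝ).2 (le_ncard_decomposablePolys_linear (F := F) mo hr1 hn)
    push_cast at hlower
    rw [← pairCount_eq_ncard mo hr1 (by omega) le_rfl] at hlower
    rw [abs_le]
    constructor <;> linarith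
  · rw [decompM, if_neg hm]
    -- Put `e = n / ℓ`. If `e` is prime, then `e ≥ 2ℓ - 4`, which parity improves to `2ℓ - 3` for
    -- odd `e`, while `e = 2` forces `ℓ = 2`. If `e` is composite, its prime factors are at least
    -- `ℓ`, so `e ≥ ℓ²`.
    have hm' : r = 2 → 2 * n.minFac ≤ n / n.minFac + 3 := by
      intro hr2
      by_cases he : (n / n.minFac).Prime
      · have h1 : ¬ ((n / n.minFac : ℕ) : ℤ) ≤ 2 * (n.minFac : ℤ) - 5 := fun h => hm ⟨hr2, he, h⟩
        rcases he.eq_two_or_odd with h2 | h2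
        · have := hlp.two_le
          omega
        · omega
      · have h1 : 2 ≤ n / n.minFac := hlp.two_le.trans hmin
        have h2 := Nat.minFac_sq_le_self (by omega) he
        have h3 : n.minFac ≤ (n / n.minFac).minFac :=
          Nat.minFac_le_of_dvd (Nat.minFac_prime (by omega)).two_le
            ((Nat.minFac_dvd _).trans (Nat.div_dvd_of_dvd n.minFac_dvd))
        have h4 := hlp.two_le
        nlinarith
    have hsum := sum_pairCount_erase_minFac_le hq hr hn hcomp hm'
    have hself : n.minFac ∈ n.divisors.filter (2 ≤ ·) :=
      Finset.mem_filter.2 ⟨Nat.mem_divisors.2 ⟨n.minFac_dvd, by omega⟩, hlp.two_le⟩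
    rw [← Finset.add_sum_erase _ _ hself] at hupper
    have hlower := pairCount_sub_le_ncard (F := F) mo hr hlp (by have := hlp.two_le; omega) hle
    rw [← decompBeta_eq] at hlower
    rw [abs_le]
    constructor <;> linarith
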